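/- Let $p$ be an odd prime, $\mathcal K$ a field of characteristic $p$, $n\ge 1$, $1\le k\le n$ and $q\in\mathcal K$. Let $\mathcal O(n;\underline 1)$ be the restricted divided power algebra over $\mathcal K$ with basis $x^{(\alpha)}$, $0\le\alpha\le\tau=(p-1,\dots,p-1)$, and product $x^{(\alpha)}x^{(\beta)}=\prod_i\binom{\alpha_i+\beta_i}{\alpha_i}x^{(\alpha+\beta)}$, where $x^{(\gamma)}=0$ if some $\gamma_j\ge p$ (equivalently $\mathcal K[x_1,\dots,x_n]/(x_1^p,\dots,x_n^p)$ with $x^{(\alpha)}=x^\alpha/\alpha!$). Let $\mathbf W(n;\underline 1)=\mathrm{Der}_{\mathcal K}\,\mathcal O(n;\underline 1)$ be the Jacobson–Witt algebra, with basis $x^{(\alpha)}D_i$ ($0\le\alpha\le\tau$, $1\le i\le n$, $D_i=\partial/\partial x_i$). Let $\mathbf u(\mathbf W(n;\underline 1))$ be its restricted universal enveloping algebra, i.e. the quotient of $U(\mathbf W(n;\underline 1))$ by the two-sided ideal generated by $(x^{(\epsilon_i)}D_i)^p-x^{(\epsilon_i)}D_i$ for all $i$ and by $(x^{(\alpha)}D_i)^p$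 for all $i$ and all $\alpha\neq\epsilon_i$, $0\le\alpha\le\tau$. Put $\mathcal K[t]_p^{(q)}=\mathcal K[t]/(t^p-qt)$ and $\mathbf u_{t,q}(\mathbf W(n;\underline 1))=\mathbf u(\mathbf W(n;\underline 1))\otimes_{\mathcal K}\mathcal K[t]_p^{(q)}$, an algebra over $\mathcal K[t]_p^{(q)}$. Let $h=x^{(\epsilon_k)}D_k$ and $e=2x^{(2\epsilon_k)}D_k$. Then $[h,e]=e$, the element $1-et$ is invertible in $\mathbf u_{t,q}(\mathbf W(n;\underline 1))$, and there is a noncommutative and noncocommutative Hopf algebra structure over $\mathcal K[t]_p^{(q)}$ on $\mathbf u_{t,q}(\mathbf W(n;\underline 1))$, with its algebra structure unchanged, such that for all $0\le\alpha\le\tau$ and $1\le i\le n$ $$\Delta(x^{(\alpha)}D_i)=x^{(\alpha)}D_i\otimes(1-et)^{\alpha_k-\delta_{ik}}+\sum_{\ell=0}^{p-1}(-1)^\ell h^{\langle\ell\rangle}\otimes(1-et)^{-\ell}\,d^{(\ell)}(x^{(\alpha)}D_i)\,t^\ell,$$ $$S(x^{(\alpha)}D_i)=-(1-et)^{\delta_{ik}-\alpha_k}\Bigl(\sum_{\ell=0}^{p-1}d^{(\ell)}(x^{(\alpha)}D_i)\,h_1^{\langle\ell\rangle}\,t^\ell\Bigr),\qquad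 \varepsilon(x^{(\alpha)}D_i)=0,$$ where $d^{(\ell)}=\frac1{\ell!}(\mathrm{ad}\,e)^\ell$, $h_a^{\langle\ell\rangle}=(h+a)(h+a+1)\cdots(h+a+\ell-1)$ and $h^{\langle\ell\rangle}=h_0^{\langle\ell\rangle}$. Moreover $\mathbf u_{t,q}(\mathbf W(n;\underline 1))$ is finite dimensional over $\mathcal K$, of dimension $p^{1+np^n}$. -/

import Mathlib

open scoped TensorProduct Nat

noncomputable section

namespace JacobsonWitt

/-! The restricted divided power algebra, its derivations, and restricted enveloping algebras -/

section Algebra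

variable (K : Type*) [Field K] (p n : ℕ)

/-- The ideal `(X_1^p, …, X_n^p)` of `K[X_1, …, X_n]`. -/
def truncIdeal : Ideal (MvPolynomial (Fin n) K) :=
  Ideal.span (Set.range fun i : Fin n => (MvPolynomial.X i : MvPolynomial (Fin n) K) ^ p)

/-- The restricted divided power algebra `O(n; 1)` over a field `K` of characteristic `p`, realised
as the truncated polynomial algebra `K[X_1, …, X_n] / (X_1^p, …, X_n^p)`; its divided power basis
is `dpow`. -/
abbrev O : Type _ := MvPolynomial (Fin n) K ⧸ truncIdeal K p n

variable {n}

/-- The divided power monomial `x^(α) = X^α / α!`, where `α! = α_1! ⋯ α_n!`.  In characteristic `p`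
it is `0` as soon as some `α_j ≥ p`. -/
def dpow (α : Fin n → ℕ) : O K p n :=
  (∏ j, ((α j)! : K))⁻¹ • Ideal.Quotient.mk (truncIdeal K p n) (∏ j, MvPolynomial.X j ^ α j)

theorem dpow_eq_zero (α : Fin n → ℕ) (j : Fin n) (hj : p ≤ α j) : dpow K p α = 0 := by
  have : (∏ j, MvPolynomial.X j ^ α j : MvPolynomial (Fin n) K) ∈ truncIdeal K p n := by
    rw [← Finset.mul_prod_erase _ _ (Finset.mem_univ j)]
    apply Ideal.mul_mem_right
    rw [← Nat.add_sub_cancel' hj, pow_add]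
    exact Ideal.mul_mem_right _ _ (Ideal.subset_span ⟨j, rfl⟩)
  rw [dpow, Ideal.Quotient.eq_zero_iff_mem.2 this, smul_zero]

/-- The multiplication rule of the restricted divided power algebra. -/
theorem dpow_mul [Fact p.Prime] [CharP K p] (α β : Fin n → ℕ)
    (hα : ∀ j, α j < p) (hβ : ∀ j, β j < p) :
    dpow K p α * dpow K p β =
      (∏ j, ((α j + β j).choose (α j) : K)) • dpow K p (fun j => α j + β j) := by
  have fac : ∀ m, m < p → (m ! : K) ≠ 0 := fun m hm h =>
    absurd (((Fact.out : p.Prime).dvd_factorial).1 ((CharP.cast_eq_zero_iff K p _).1 h))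
      (not_le.2 hm)
  have key : (Ideal.Quotient.mk (truncIdeal K p n) (∏ j, MvPolynomial.X j ^ (α j + β j))) =
      (∏ j, ((α j + β j)! : K)) • dpow K p (fun j => α j + β j) := by
    by_cases h : ∀ j, α j + β j < p
    · rw [dpow, smul_smul, mul_inv_cancel₀ (Finset.prod_ne_zero_iff.2 fun j _ => fac _ (h j)),
        one_smul]
    · push Not at h
      obtain ⟨j, hj⟩ := h
      rw [dpow_eq_zero K p _ j hj, smul_zero]
      apply Ideal.Quotient.eq_zero_iff_mem.2
      rw [← Finset.mul_prod_erase _ _ (Finset.mem_univ j)]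
      apply Ideal.mul_mem_right
      rw [← Nat.add_sub_cancel' hj, pow_add]
      exact Ideal.mul_mem_right _ _ (Ideal.subset_span ⟨j, rfl⟩)
  have hprod : (∏ j, MvPolynomial.X j ^ α j : MvPolynomial (Fin n) K) *
      ∏ j, MvPolynomial.X j ^ β j = ∏ j, MvPolynomial.X j ^ (α j + β j) := by
    rw [← Finset.prod_mul_distrib]; simp [pow_add]
  rw [dpow, dpow, smul_mul_smul_comm, ← map_mul, hprod, key, smul_smul]
  congr 1
  rw [← Finset.prod_inv_distrib, ← Finset.prod_inv_distrib, ← Finset.prod_mul_distrib,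
    ← Finset.prod_mul_distrib]
  refine Finset.prod_congr rfl fun j _ => ?_
  have h1 := fac _ (hα j)
  have h2 := fac _ (hβ j)
  have h3 : ((α j + β j).choose (α j) : K) * (α j)! * (β j)! = (α j + β j)! := by
    have := Nat.choose_mul_factorial_mul_factorial (Nat.le_add_right (α j) (β j))
    rw [Nat.add_sub_cancel_left] at this
    exact_mod_cast congrArg (Nat.cast (R := K)) this
  rw [← h3]
  field_simp

variable (n) in
/-- The Jacobson-Witt algebra `W(n; 1) = Der_K O(n; 1)`, with the commutator bracket. -/
abbrev W : Type _ := Derivation K (O K p n) (O K p n)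

variable [CharP K p]

theorem pderiv_mem (i : Fin n) (f : MvPolynomial (Fin n) K) (hf : f ∈ truncIdeal K p n) :
    MvPolynomial.pderiv i f ∈ truncIdeal K p n := by
  induction hf using Submodule.span_induction with
  | mem f hf =>
    obtain ⟨j, rfl⟩ := hf
    simp [Derivation.leibniz_pow]
  | zero => simp
  | add f g _ _ hf hg => simpa using add_mem hf hg
  | smul a f hf ih =>
    rw [smul_eq_mul, Derivation.leibniz]
    exact add_mem (Ideal.mul_mem_left _ _ ih) (by
      rw [smul_eq_mul]; exact Ideal.mul_mem_right _ _ hf)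

/-- The partial derivative `D_i` on `O(n; 1)`, induced by `∂/∂X_i` on polynomials. -/
def D (i : Fin n) : W K p n :=
  Derivation.mk'
    (Submodule.mapQ ((truncIdeal K p n).restrictScalars K) ((truncIdeal K p n).restrictScalars K)
      (MvPolynomial.pderiv i : Derivation K (MvPolynomial (Fin n) K) _).toLinearMap
      (fun f hf => pderiv_mem K p i f hf))
    (by
      intro a b
      obtain ⟨f, rfl⟩ := Ideal.Quotient.mk_surjective a
      obtain ⟨g, rfl⟩ := Ideal.Quotient.mk_surjective b
      change Ideal.Quotient.mk (truncIdeal K p n) (MvPolynomial.pderiv i (f * g)) = _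
      rw [Derivation.leibniz, map_add]
      rfl)

theorem D_mk (i : Fin n) (f : MvPolynomial (Fin n) K) :
    D K p i (Ideal.Quotient.mk (truncIdeal K p n) f) =
      Ideal.Quotient.mk (truncIdeal K p n) (MvPolynomial.pderiv i f) := rfl

/-- The element `x^(α) D_i` of `W(n; 1)`. -/
def xD (α : Fin n → ℕ) (i : Fin n) : W K p n := dpow K p α • D K p i

/-- The distinguished element `h = x^(ε_k) D_k`. -/
def hW (k : Fin n) : W K p n := xD K p (Pi.single k 1) k

/-- The distinguished element `e = 2 x^(2 ε_k) D_k`. -/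
def eW (k : Fin n) : W K p n := (2 : K) • xD K p (Pi.single k 2) k

/-- The operator `d^(ℓ) = (ad e)^ℓ / ℓ!` on `W(n; 1)`, used for `ℓ < p` only. -/
def dOp (k : Fin n) (ℓ : ℕ) (w : W K p n) : W K p n :=
  ((ℓ ! : K))⁻¹ • ((LieAlgebra.ad K (W K p n) (eW K p k)) ^ ℓ) w

variable (n)

/-- The relations `(x^(ε_i) D_i)^p = x^(ε_i) D_i`, and `(x^(α) D_i)^p = 0` for all other basis
elements `x^(α) D_i`, `0 ≤ α ≤ (p-1, …, p-1)`, in the universal enveloping algebra of `W(n; 1)`. -/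
inductive PRel : UniversalEnvelopingAlgebra K (W K p n) →
    UniversalEnvelopingAlgebra K (W K p n) → Prop
  | toral (i : Fin n) :
      PRel (UniversalEnvelopingAlgebra.ι K (xD K p (Pi.single i 1) i) ^ p)
        (UniversalEnvelopingAlgebra.ι K (xD K p (Pi.single i 1) i))
  | nil (α : Fin n → ℕ) (i : Fin n) (hα : ∀ j, α j < p) (hne : α ≠ Pi.single i 1) :
      PRel (UniversalEnvelopingAlgebra.ι K (xD K p α i) ^ p) 0

/-- The restricted universal enveloping algebra `u(W(n; 1))`. -/
abbrev RestrictedU : Type _ := RingQuot (PRel K p n)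

/-- The `p`-dimensional truncated polynomial ring `K[t]_p^(q) = K[t] / (t^p - q t)`. -/
abbrev BaseRing (q : K) : Type _ :=
  AdjoinRoot (Polynomial.X ^ p - Polynomial.C q * Polynomial.X : Polynomial K)

/-- The algebra `u_{t,q}(W(n; 1)) = K[t]_p^(q) ⊗ u(W(n; 1))`, an algebra over `K[t]_p^(q)`. -/
abbrev Utq (q : K) : Type _ := BaseRing K p q ⊗[K] RestrictedU K p n

variable {n}

/-- The class `t` in `K[t]_p^(q)`. -/
def t (q : K) : BaseRing K p q := AdjoinRoot.root _

/-- The canonical map from `W(n; 1)` to `u_{t,q}(W(n; 1))`. -/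
def toUtq (q : K) (w : W K p n) : Utq K p n q :=
  1 ⊗ₜ[K] RingQuot.mkAlgHom K (PRel K p n) (UniversalEnvelopingAlgebra.ι K w)

end Algebra

/-- The rising factorial `x_a^⟨m⟩ = (x + a) (x + a + 1) ⋯ (x + a + m - 1)`. -/
def rising {A : Type*} [Ring A] (x a : A) : ℕ → A
  | 0 => 1
  | m + 1 => rising x a m * (x + a + (m : A))

/-- A Hopf algebra structure on an `R`-algebra `A` whose underlying algebra structure is the given
one. -/
structure HopfStructure (R A : Type*) [CommRing R] [Ring A] [Algebra R A] where
  comul : A →ₐ[R] A ⊗[R] A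
  counit : A →ₐ[R] R
  antipode : A →ₗ[R] A
  coassoc : (Algebra.TensorProduct.assoc R R R A A A).toAlgHom.comp
      ((Algebra.TensorProduct.map comul (.id R A)).comp comul) =
    (Algebra.TensorProduct.map (.id R A) comul).comp comul
  counit_left : (Algebra.TensorProduct.map counit (.id R A)).comp comul =
    (Algebra.TensorProduct.lid R A).symm
  counit_right : (Algebra.TensorProduct.map (.id R A) counit).comp comul =
    (Algebra.TensorProduct.rid R R A).symm
  antipode_left : LinearMap.mul' R A ∘ₗ antipode.rTensor A ∘ₗ comul.toLinearMap =
    Algebra.linearMap R A ∘ₗ counit.toLinearMap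
  antipode_right : LinearMap.mul' R A ∘ₗ antipode.lTensor A ∘ₗ comul.toLinearMap =
    Algebra.linearMap R A ∘ₗ counit.toLinearMap

/-- The Mathlib Hopf algebra with the given structure maps. -/
@[reducible] def HopfStructure.toHopfAlgebra {R A : Type*} [CommRing R] [Ring A] [Algebra R A]
    (H : HopfStructure R A) : HopfAlgebra R A :=
  letI : Bialgebra R A :=
    Bialgebra.ofAlgHom H.comul H.counit H.coassoc H.counit_left H.counit_right
  { antipode := H.antipode
    mul_antipode_rTensor_comul := H.antipode_left
    mul_antipode_lTensor_comul := H.antipode_right }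

/-- The Hopf algebra structure is cocommutative: `Δ` is invariant under the flip. -/
def HopfStructure.Cocommutative {R A : Type*} [CommRing R] [Ring A] [Algebra R A]
    (H : HopfStructure R A) : Prop :=
  ∀ a : A, TensorProduct.comm R A A (H.comul a) = H.comul a

end JacobsonWitt

end

/-! The Hopf structure is a Drinfeld twist of the standard one, in which the elements of W(n;1) are
primitive. Since h^p = h, Lagrange interpolation on the prime field gives orthogonal projectors E_a,
a in F_p, onto the eigenspaces of h. Since e^p = 0 in characteristic p, (1-et)^p = 1, so (1-et)^a
makes sense for a residue a. The twist is the finite sum F = Σ_a E_a ⊗ (1-et)^a. Then Δ = F Δ₀ F⁻¹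
and S = V⁻¹ S₀ V with V = Σ_a E_a (1-et)^a, while the counit is unchanged. The maps Δ₀, ε, S₀ come
from the universal property of the restricted enveloping algebra; p odd makes x ↦ -x compatible with
p-th powers.

On a generator x of ad h-weight c, Δx = x ⊗ (1-et)^c + Σ_a E_a ⊗ (1-et)^a x (1-et)^(-a)
(`IsWeight.comul_eq`), and the Hopf axioms are checked on generators in this form. For the closed
formula, right multiplication by 1-et is left multiplication plus t·ad e, and these commute. The
binomial theorem (`mul_P`) moves (1-et)^(-a) to the left of x at the cost of falling factorials of
-a, and the projectors turn these into h^⟨ℓ⟩. The antipode formula is the analogous computation of x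
V (`IsWeight.mul_V`).

Noncommutativity is [h,e] = e ≠ 0. For noncocommutativity, Δh = 1 ⊗ h + h ⊗ (1-et)⁻¹ is tested
against a matrix coefficient of the representation on O(n;1) that is 1 on h and 0 on eA.

The dimension is a restricted PBW theorem. Straightening shows that ordered monomials with exponents
below p span (`span_orderedMonomials`). They are independent
(`LocalFrame.linearIndependent_orderedMonomials`) because W(n;1) acts by derivations on the
polynomial functions on End O(n;1), where its basis has independent tangent vectors at the identity;
a longest monomial is detected by differentiating the matching monomial in local coordinates. -/

noncomputable section

/-! ### Restricted PBW: ordered monomials span. -/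

section OrderedMonomials

/-- The word in which each letter `i` occurs `a i` times, in a fixed order of the letters. -/
def expWord {ι : Type*} [Fintype ι] (a : ι → ℕ) : List ι :=
  Finset.univ.toList.flatMap fun i => List.replicate (a i) i

theorem count_expWord {ι : Type*} [Fintype ι] [DecidableEq ι] (a : ι → ℕ) (j : ι) :
    (expWord a).count j = a j := by
  rw [expWord, List.count_flatMap]
  simp only [Function.comp_def, List.count_replicate]
  rw [Finset.sum_map_toList]
  simp

theorem perm_expWord_count {ι : Type*} [Fintype ι] [DecidableEq ι] (l : List ι) :
    l.Perm (expWord fun i => l.count i) :=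
  List.perm_iff_count.2 fun j => (count_expWord (fun i => l.count i) j).symm

variable {K A ι : Type*} [Field K] [Ring A] [Algebra K A]

/-- The span of the products of at most `m` of the elements `x i`. -/
def wordSpan (K : Type*) {A ι : Type*} [Field K] [Ring A] [Algebra K A] (x : ι → A) (m : ℕ) :
    Submodule K A :=
  Submodule.span K {y | ∃ l : List ι, l.length ≤ m ∧ (l.map x).prod = y}

theorem word_mem_wordSpan (x : ι → A) {m : ℕ} (l : List ι) (hl : l.length ≤ m) :
    (l.map x).prod ∈ wordSpan K x m :=
  Submodule.subset_span ⟨l, hl, rfl⟩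

theorem wordSpan_mono (x : ι → A) {m m' : ℕ} (h : m ≤ m') : wordSpan K x m ≤ wordSpan K x m' :=
  Submodule.span_mono fun _ ⟨l, hl, hy⟩ => ⟨l, hl.trans h, hy⟩

theorem wordSpan_mul (x : ι → A) {m m' : ℕ} {y z : A} (hy : y ∈ wordSpan K x m)
    (hz : z ∈ wordSpan K x m') : y * z ∈ wordSpan K x (m + m') := by
  have h : y * z ∈ wordSpan K x m * wordSpan K x m' := Submodule.mul_mem_mul hy hz
  rw [wordSpan, wordSpan, Submodule.span_mul_span] at h
  refine Submodule.span_mono ?_ h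
  rintro _ ⟨_, ⟨l, hl, rfl⟩, _, ⟨l', hl', rfl⟩, rfl⟩
  exact ⟨l ++ l', by simpa using add_le_add hl hl', by simp⟩

theorem span_range_le_wordSpan (x : ι → A) : Submodule.span K (Set.range x) ≤ wordSpan K x 1 := by
  refine Submodule.span_le.2 ?_
  rintro _ ⟨i, rfl⟩
  exact Submodule.subset_span ⟨[i], by simp, by simp⟩

/-- An adjacent transposition changes a word by a commutator of two letters, which is a combination
of single letters, so the difference involves only words shorter by one. -/
theorem perm_sub_mem_wordSpan (x : ι → A)
    (hcomm : ∀ i j, x i * x j - x j * x i ∈ Submodule.span K (Set.range x))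
    {l l' : List ι} (h : l.Perm l') :
    (l.map x).prod - (l'.map x).prod ∈ wordSpan K x (l.length - 1) := by
  induction h with
  | nil => simp
  | @cons i l l' h ih =>
    rw [List.map_cons, List.map_cons, List.prod_cons, List.prod_cons, ← mul_sub]
    rcases l with _ | ⟨j, l⟩
    · rw [List.nil_perm.1 h]; simp
    · have := wordSpan_mul x (word_mem_wordSpan (K := K) x [i] le_rfl) ih
      simp only [List.map_cons, List.map_nil, List.prod_cons, List.prod_nil, mul_one] at this
      refine wordSpan_mono x ?_ this
      simp; omega
  | swap i j l =>
    simp only [List.map_cons, List.prod_cons, ← mul_assoc, ← sub_mul]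
    have := wordSpan_mul x (span_range_le_wordSpan x (hcomm j i))
      (word_mem_wordSpan (K := K) x l le_rfl)
    refine wordSpan_mono x ?_ this
    simp; omega
  | trans h h' ih ih' =>
    rw [← sub_add_sub_cancel]
    exact add_mem ih (by rwa [h.length_eq])

/-- The upper bound in the restricted Poincaré-Birkhoff-Witt theorem: ordered monomials with
exponents below `p` span. -/
theorem span_orderedMonomials [Fintype ι] {p : ℕ} (hp : 2 ≤ p) (x : ι → A)
    (hgen : Algebra.adjoin K (Set.range x) = ⊤)
    (hcomm : ∀ i j, x i * x j - x j * x i ∈ Submodule.span K (Set.range x))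
    (hpow : ∀ i, x i ^ p ∈ Submodule.span K (Set.range x)) :
    Submodule.span K (Set.range fun a : ι → Fin p =>
      ((expWord fun i => (a i : ℕ)).map x).prod) = ⊤ := by
  classical
  set M := Submodule.span K (Set.range fun a : ι → Fin p =>
      ((expWord fun i => (a i : ℕ)).map x).prod) with hM
  have key : ∀ m, wordSpan K x m ≤ M := by
    intro m
    induction m with
    | zero =>
      refine Submodule.span_le.2 ?_
      rintro _ ⟨l, hl, rfl⟩
      rw [List.length_eq_zero_iff.1 (Nat.le_zero.1 hl)]
      refine Submodule.subset_span ⟨fun _ => ⟨0, by omega⟩, ?_⟩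
      have : (expWord fun _ : ι => 0) = [] := by simp [expWord]
      simp [this]
    | succ m ih =>
      refine Submodule.span_le.2 ?_
      rintro _ ⟨l, hl, rfl⟩
      have swap : ∀ l', l.Perm l' → (l'.map x).prod ∈ M → (l.map x).prod ∈ M := by
        intro l' h h'
        rw [← sub_add_cancel (l.map x).prod (l'.map x).prod]
        exact add_mem (ih (wordSpan_mono x (by omega) (perm_sub_mem_wordSpan x hcomm h))) h'
      -- Modulo shorter words the letters may be reordered freely: either the word sorts to an
      -- admissible monomial, or p equal letters can be gathered and their product replaced by a
      -- linear expression, which shortens the word.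
      by_cases hc : ∀ i, l.count i < p
      · exact swap _ (perm_expWord_count l)
          (Submodule.subset_span ⟨fun i => ⟨l.count i, hc i⟩, rfl⟩)
      · push Not at hc
        obtain ⟨i, hi⟩ := hc
        set l' := expWord (Function.update (fun j => l.count j) i (l.count i - p)) with hl'
        have hperm : l.Perm (List.replicate p i ++ l') := by
          refine List.perm_iff_count.2 fun j => ?_
          rw [List.count_append, hl', count_expWord, List.count_replicate]
          by_cases hj : i = j
          · subst hj; simp; omega
          · simp [hj, Function.update_of_ne (Ne.symm hj)]
        have hlen := hperm.length_eq
        rw [List.length_append, List.length_replicate] at hlen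
        refine swap _ hperm ?_
        rw [List.map_append, List.prod_append, List.map_replicate, List.prod_replicate]
        exact ih (wordSpan_mono x (by omega) (wordSpan_mul x (span_range_le_wordSpan x (hpow i))
          (word_mem_wordSpan (K := K) x l' le_rfl)))
  rw [eq_top_iff, ← Algebra.top_toSubmodule, ← hgen, Algebra.adjoin_eq_span]
  refine Submodule.span_le.2 fun y hy => ?_
  obtain ⟨l, hl, rfl⟩ := Submonoid.exists_list_of_mem_closure hy
  obtain ⟨l', rfl⟩ : ∃ l' : List ι, l'.map x = l := by
    clear hy
    induction l with
    | nil => exact ⟨[], rfl⟩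
    | cons a l ih =>
      obtain ⟨i, hi⟩ := hl a (by simp)
      obtain ⟨l', hl'⟩ := ih fun y hy => hl y (by simp [hy])
      exact ⟨i :: l', by simp [hi, hl']⟩
  exact key _ (word_mem_wordSpan x l' le_rfl)

end OrderedMonomials

/-! ### Frobenius powers of derivations. -/

section DerivationPower

variable {K C : Type*} [Field K] [CommRing C] [Algebra K C] (p : ℕ) [Fact p.Prime] [CharP K p]

/-- In characteristic `p`, the `p`-th power of a derivation is a derivation. -/
theorem Derivation.pow_char_leibniz (X : Derivation K C C) (f g : C) :
    ((X : C →ₗ[K] C) ^ p) (f * g) = f * ((X : C →ₗ[K] C) ^ p) g + g * ((X : C →ₗ[K] C) ^ p) f := by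
  have hp : p.Prime := Fact.out
  have key : ∀ m : ℕ, ((X : C →ₗ[K] C) ^ m) (f * g) =
      ∑ ij ∈ Finset.HasAntidiagonal.antidiagonal m, m.choose ij.1 •
        (((X : C →ₗ[K] C) ^ ij.1) f * ((X : C →ₗ[K] C) ^ ij.2) g) := by
    intro m
    induction m with
    | zero => simp
    | succ m ih =>
      rw [pow_succ', Module.End.mul_apply, ih, map_sum, Finset.sum_antidiagonal_choose_succ_nsmul
        (M := C) (fun i j => ((X : C →ₗ[K] C) ^ i) f * ((X : C →ₗ[K] C) ^ j) g) m,
        ← Finset.sum_add_distrib]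
      refine Finset.sum_congr rfl fun ij hij => ?_
      rw [m.choose_symm_of_eq_add (Finset.HasAntidiagonal.mem_antidiagonal.1 hij).symm, ← smul_add, map_nsmul,
        pow_succ', pow_succ', Module.End.mul_apply, Module.End.mul_apply]
      simp only [Derivation.coeFn_coe, Derivation.leibniz, smul_eq_mul]
      ring
  -- In the general Leibniz formula for m = p, all but the two extreme binomial coefficients are
  -- divisible by p.
  rw [key, Finset.Nat.sum_antidiagonal_eq_sum_range_succ_mk, Finset.sum_range_succ,
    Finset.range_eq_Ico, Finset.sum_eq_sum_Ico_succ_bot hp.pos, Finset.sum_eq_zero]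
  · simp [mul_comm g, add_comm]
  · intro i hi
    rw [Finset.mem_Ico] at hi
    rw [← Nat.cast_smul_eq_nsmul K, (CharP.cast_eq_zero_iff K p _).2
      (hp.dvd_choose_self (by omega) hi.2), zero_smul]

/-- The derivation given by the `p`-th power of a derivation in characteristic `p`. -/
def Derivation.powChar (X : Derivation K C C) : Derivation K C C :=
  Derivation.mk' ((X : C →ₗ[K] C) ^ p) fun f g => X.pow_char_leibniz p f g

end DerivationPower

/-! ### Independence of monomials in derivations, from a frame at a point. -/

section Independence

open MvPolynomial

variable {K C ι : Type*} [Field K] [CommRing C] [Algebra K C]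

/-- A derivation lowers the order of vanishing by at most one. -/
theorem Derivation.mem_pow_of_mem_pow_succ (X : Derivation K C C) (M : Ideal C) (m : ℕ) {f : C}
    (hf : f ∈ M ^ (m + 1)) : X f ∈ M ^ m := by
  induction m generalizing f with
  | zero => simp
  | succ m ih =>
    rw [pow_succ] at hf
    induction hf using Submodule.mul_induction_on' with
    | mem_mul_mem a ha b hb =>
      rw [Derivation.leibniz]
      refine add_mem (Ideal.mul_mem_right _ _ ha) ?_
      rw [smul_eq_mul, mul_comm, pow_succ]
      exact Ideal.mul_mem_mul (ih ha) hb
    | add a _ b _ ha hb => rw [map_add]; exact add_mem ha hb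

/-- Coordinates `u` at the point `ε`, and derivations dual to them to first order. -/
structure LocalFrame (ε : C →ₐ[K] K) (X : ι → Derivation K C C) (u : ι → C) : Prop where
  map_coord : ∀ j, ε (u j) = 0
  map_deriv : ∀ i j, i ≠ j → ε (X i (u j)) = 0
  map_deriv_self : ∀ i, ε (X i (u i)) = 1

variable {ε : C →ₐ[K] K} {X : ι → Derivation K C C} {u : ι → C}

theorem LocalFrame.aeval_mem (h : LocalFrame ε X u) {m : ℕ} {P : MvPolynomial ι K}
    (hP : P ∈ idealOfVars ι K ^ m) : aeval u P ∈ RingHom.ker ε ^ m := by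
  have hle : (idealOfVars ι K).map (aeval u : MvPolynomial ι K →ₐ[K] C) ≤ RingHom.ker ε := by
    rw [idealOfVars, Ideal.map_span, Ideal.span_le]
    rintro _ ⟨_, ⟨j, rfl⟩, rfl⟩
    simpa using h.map_coord j
  refine Ideal.pow_right_mono hle m ?_
  rw [← Ideal.map_pow]
  exact Ideal.mem_map_of_mem _ hP

/-- To leading order X i acts on polynomials in u as the partial derivative: X i (u j) differs from
the Kronecker delta by an element of the maximal ideal, so the error keeps order m where the
derivatives have order m - 1. -/
theorem LocalFrame.deriv_aeval_sub_mem (h : LocalFrame ε X u) (i : ι) {m : ℕ}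
    {P : MvPolynomial ι K} (hP : P ∈ idealOfVars ι K ^ m) :
    X i (aeval u P) - aeval u (pderiv i P) ∈ RingHom.ker ε ^ m := by
  classical
  induction m generalizing P with
  | zero => simp
  | succ m ih =>
    rw [pow_succ] at hP
    induction hP using Submodule.mul_induction_on' with
    | add a _ b _ ha hb =>
      rw [map_add, map_add, map_add, map_add, add_sub_add_comm]
      exact add_mem ha hb
    | mem_mul_mem a ha b hb =>
      have hb' : aeval u b ∈ RingHom.ker ε := by
        simpa using h.aeval_mem (m := 1) (by simpa using hb)
      have hb2 : X i (aeval u b) - aeval u (pderiv i b) ∈ RingHom.ker ε := by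
        clear hb'
        rw [idealOfVars] at hb
        induction hb using Submodule.span_induction with
        | mem b hb =>
          obtain ⟨j, rfl⟩ := hb
          by_cases hij : j = i
          · subst hij; simp [h.map_deriv_self]
          · simp [h.map_deriv i j (Ne.symm hij), pderiv_X_of_ne hij]
        | zero => simp
        | add b c _ _ hb hc =>
          rw [map_add, map_add, map_add, map_add, add_sub_add_comm]
          exact add_mem hb hc
        | smul r b hb ih =>
          have hb' : aeval u b ∈ RingHom.ker ε := by
            simpa using h.aeval_mem (m := 1) (by simpa [idealOfVars] using hb)
          have e : X i (aeval u (r • b)) - aeval u (pderiv i (r • b)) =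
              aeval u r * (X i (aeval u b) - aeval u (pderiv i b)) +
              (X i (aeval u r) - aeval u (pderiv i r)) * aeval u b := by
            simp only [map_mul, Derivation.leibniz, map_add, smul_eq_mul]
            ring
          rw [e]
          exact add_mem (Ideal.mul_mem_left _ _ ih) (Ideal.mul_mem_left _ _ hb')
      have e : X i (aeval u (a * b)) - aeval u (pderiv i (a * b)) =
          aeval u a * (X i (aeval u b) - aeval u (pderiv i b)) +
          (X i (aeval u a) - aeval u (pderiv i a)) * aeval u b := by
        simp only [map_mul, Derivation.leibniz, map_add, smul_eq_mul]
        ring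
      rw [e, pow_succ]
      exact add_mem (Ideal.mul_mem_mul (h.aeval_mem ha) hb2) (Ideal.mul_mem_mul (ih ha) hb')

/-- The composite of derivations along a word. -/
def wordDeriv {B : Type*} [CommRing B] [Algebra K B] (X : ι → Derivation K B B) (l : List ι) :
    Module.End K B :=
  (l.map fun i => (X i : B →ₗ[K] B)).prod

theorem wordDeriv_cons {B : Type*} [CommRing B] [Algebra K B] (X : ι → Derivation K B B) (i : ι)
    (l : List ι) (f : B) : wordDeriv X (i :: l) f = X i (wordDeriv X l f) := by
  simp [wordDeriv]

theorem wordDeriv_mem (X : ι → Derivation K C C) (M : Ideal C) (l : List ι) (m : ℕ) {f : C}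
    (hf : f ∈ M ^ (m + l.length)) : wordDeriv X l f ∈ M ^ m := by
  induction l generalizing m with
  | nil => simpa [wordDeriv] using hf
  | cons i l ih =>
    rw [wordDeriv_cons]
    exact (X i).mem_pow_of_mem_pow_succ M m (ih (m + 1) (by
      rw [List.length_cons] at hf; convert hf using 2; ring))

/-- The leading-order comparison iterated along a word: each derivation costs at most one order of
vanishing, so the error stays one order smaller than the main term. -/
theorem LocalFrame.wordDeriv_aeval_sub_mem (h : LocalFrame ε X u) (l : List ι) (m : ℕ)
    {P : MvPolynomial ι K} (hP : P ∈ idealOfVars ι K ^ (m + l.length)) :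
    wordDeriv X l (aeval u P) - aeval u (wordDeriv pderiv l P) ∈ RingHom.ker ε ^ (m + 1) := by
  induction l generalizing m with
  | nil => simp [wordDeriv]
  | cons i l ih =>
    rw [List.length_cons, add_comm l.length, ← add_assoc] at hP
    rw [wordDeriv_cons, wordDeriv_cons, ← sub_add_sub_cancel _ (X i (aeval u (wordDeriv pderiv l P)))]
    rw [← map_sub]
    exact add_mem ((X i).mem_pow_of_mem_pow_succ _ _ (ih (m + 1) hP))
      (h.deriv_aeval_sub_mem i (wordDeriv_mem _ _ _ _ hP))

/-- The constant is the product of the factorials of the multiplicities, nonzero because each is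
below p. The induction peels off the last letter, which acts first. -/
theorem exists_constantCoeff_wordDeriv [Fintype ι] [DecidableEq ι] (p : ℕ) [Fact p.Prime]
    [CharP K p] (l : List ι) (hl : ∀ i, l.count i < p) : ∃ c : K, c ≠ 0 ∧ ∀ P : MvPolynomial ι K,
      constantCoeff (wordDeriv pderiv l P) =
        c * coeff (Finsupp.equivFunOnFinite.symm fun i => l.count i) P := by
  induction l using List.reverseRecOn with
  | nil =>
    refine ⟨1, one_ne_zero, fun P => ?_⟩
    have : (Finsupp.equivFunOnFinite.symm fun i => List.count i ([] : List ι)) = 0 := by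
      ext; simp
    rw [this, one_mul]; rfl
  | append_singleton l i ih =>
    obtain ⟨c, hc, h⟩ := ih fun j => lt_of_le_of_lt (by simp) (hl j)
    have hi : l.count i + 1 < p := by simpa using hl i
    refine ⟨c * ((l.count i + 1 : ℕ) : K), mul_ne_zero hc fun h0 => ?_, fun P => ?_⟩
    · exact absurd (Nat.le_of_dvd (by omega) ((CharP.cast_eq_zero_iff K p _).1 h0)) (by omega)
    · have e1 : wordDeriv pderiv (l ++ [i]) P = wordDeriv pderiv l (pderiv i P) := by
        simp [wordDeriv]
      have e2 : (Finsupp.equivFunOnFinite.symm fun j => (l ++ [i]).count j) =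
          (Finsupp.equivFunOnFinite.symm fun j => l.count j) + Finsupp.single i 1 := by
        ext j
        simp [List.count_singleton, Finsupp.single_apply]
      rw [e1, h, coeff_pderiv, e2]
      simp; ring

/-- The lower bound in the restricted Poincaré-Birkhoff-Witt theorem: if the `x i` act on a
commutative algebra by derivations that form a frame at some point, then the ordered monomials
with exponents below `p` in the `x i` are linearly independent. -/
theorem LocalFrame.linearIndependent_orderedMonomials [Fintype ι] {p : ℕ} [Fact p.Prime] [CharP K p]
    (h : LocalFrame ε X u) {A : Type*} [Ring A] [Algebra K A] (ρ : A →ₐ[K] Module.End K C)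
    (x : ι → A) (hρ : ∀ i, ρ (x i) = (X i : C →ₗ[K] C)) :
    LinearIndependent K fun a : ι → Fin p => ((expWord fun i => (a i : ℕ)).map x).prod := by
  classical
  rw [Fintype.linearIndependent_iff]
  intro g hg
  by_contra! hne
  -- Take a longest monomial b in the relation and apply the relation to u^b, then evaluate at the
  -- point. No other occurring monomial is longer, so only leading terms matter and only b
  -- contributes.
  obtain ⟨b, hb, hmax⟩ := Finset.exists_max_image
    (Finset.univ.filter fun a => g a ≠ 0) (fun a : ι → Fin p => (expWord fun i => (a i : ℕ)).length)
    (by obtain ⟨b, hb⟩ := hne; exact ⟨b, by simpa using hb⟩)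
  simp only [Finset.mem_filter, Finset.mem_univ, true_and] at hb hmax
  set μ : (ι → Fin p) → ι →₀ ℕ := fun a => Finsupp.equivFunOnFinite.symm fun i => (a i : ℕ) with hμ
  have hμinj : Function.Injective μ := fun a a' e => by
    ext i; simpa [hμ] using DFunLike.congr_fun e i
  have hdeg : (μ b).degree = (expWord fun i => (b i : ℕ)).length := by
    rw [Finsupp.degree_eq_sum, expWord, List.length_flatMap]
    simp only [List.length_replicate]
    rw [Finset.sum_map_toList]
    simp [hμ]
  have hmem : monomial (μ b) (1 : K) ∈ idealOfVars ι K ^ (expWord fun i => (b i : ℕ)).length := by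
    rw [monomial_mem_pow_idealOfVars_iff _ _ one_ne_zero, ← hdeg]
  have key : ∀ a, g a ≠ 0 → ∃ c : K, c ≠ 0 ∧
      ε (ρ ((expWord fun i => (a i : ℕ)).map x).prod (aeval u (monomial (μ b) (1 : K)))) =
        if a = b then c else 0 := by
    intro a ha
    obtain ⟨c, hc, hcoef⟩ := exists_constantCoeff_wordDeriv (K := K) p (expWord fun i => (a i : ℕ))
      (fun i => by rw [count_expWord]; exact (a i).2)
    refine ⟨c, hc, ?_⟩
    have e1 : ρ ((expWord fun i => (a i : ℕ)).map x).prod = wordDeriv X (expWord fun i => (a i : ℕ)) := by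
      rw [map_list_prod, List.map_map, wordDeriv]
      congr 2
      funext i
      exact hρ i
    obtain ⟨m, hm⟩ := Nat.exists_eq_add_of_le' (hmax a ha)
    rw [hm] at hmem
    have h1 := Ideal.pow_le_self (by omega) (h.wordDeriv_aeval_sub_mem _ m hmem)
    rw [RingHom.mem_ker, map_sub, sub_eq_zero] at h1
    have h2 : ∀ P : MvPolynomial ι K, ε (aeval u P) = constantCoeff P := by
      intro P
      have : ε.comp (aeval u) = (MvPolynomial.aeval (fun _ => (0 : K))) := by
        ext j; simp [h.map_coord]
      have := DFunLike.congr_fun this P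
      simpa [MvPolynomial.aeval_zero'] using this
    rw [e1, h1, h2, hcoef]
    have e3 : (Finsupp.equivFunOnFinite.symm fun i => (expWord fun i => (a i : ℕ)).count i) = μ a := by
      ext i; simp [hμ, count_expWord]
    rw [e3, coeff_monomial]
    by_cases hab : a = b
    · simp [hab]
    · rw [if_neg (fun e => hab (hμinj e).symm), if_neg hab, mul_zero]
  have h0 := congrArg (fun y => ε (ρ y (aeval u (monomial (μ b) (1 : K))))) hg
  simp only [map_sum, map_smul, LinearMap.sum_apply, LinearMap.smul_apply, map_zero,
    LinearMap.zero_apply] at h0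
  rw [Finset.sum_eq_single b] at h0
  · obtain ⟨c, hc, e⟩ := key b hb
    rw [e, if_pos rfl, smul_eq_mul] at h0
    exact mul_ne_zero hb hc h0
  · intro a _ hab
    by_cases ha : g a = 0
    · simp [ha]
    · obtain ⟨c, hc, e⟩ := key a ha
      rw [e, if_neg hab, smul_zero]
  · simp

end Independence

namespace JacobsonWitt

/-! ### The monomial basis of O(n;1). -/

section TruncatedPolynomials

variable (K : Type*) [Field K] (p n : ℕ)

/-- The ideal is generated by monomials, so membership can be read off supports. This makes the
coefficients below p well defined on the quotient. -/
theorem coeff_eq_zero_of_mem_truncIdeal {f : MvPolynomial (Fin n) K} (hf : f ∈ truncIdeal K p n)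
    (β : Fin n →₀ ℕ) (hβ : ∀ j, β j < p) : f.coeff β = 0 := by
  have : truncIdeal K p n = Ideal.span ((fun s => MvPolynomial.monomial s (1 : K)) ''
      Set.range fun i : Fin n => Finsupp.single i p) := by
    rw [truncIdeal, ← Set.range_comp]
    congr 2
    funext i
    simp [MvPolynomial.X_pow_eq_monomial]
  rw [this, MvPolynomial.mem_ideal_span_monomial_image] at hf
  by_contra h
  obtain ⟨_, ⟨i, rfl⟩, hi⟩ := hf β (MvPolynomial.mem_support_iff.2 h)
  exact absurd (Finsupp.single_le_iff.1 hi) (not_le.2 (hβ i))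

variable {n}

/-- The exponent vector with entries below `p` as a finitely supported function. -/
def expFinsupp (β : Fin n → Fin p) : Fin n →₀ ℕ :=
  Finsupp.equivFunOnFinite.symm fun j => (β j : ℕ)

/-- The coefficient of the monomial with exponent `β` on `O(n; 1)`. -/
def ocoeff (β : Fin n → Fin p) : O K p n →ₗ[K] K :=
  ((truncIdeal K p n).restrictScalars K).liftQ (MvPolynomial.lcoeff K (expFinsupp p β))
    fun _ hf => coeff_eq_zero_of_mem_truncIdeal K p n hf _ fun j => (β j).2

theorem ocoeff_mk (β : Fin n → Fin p) (f : MvPolynomial (Fin n) K) :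
    ocoeff K p β (Ideal.Quotient.mk (truncIdeal K p n) f) = f.coeff (expFinsupp p β) := rfl

/-- The class of the monomial with exponent `β` in `O(n; 1)`. -/
def omono (β : Fin n → Fin p) : O K p n :=
  Ideal.Quotient.mk (truncIdeal K p n) (MvPolynomial.monomial (expFinsupp p β) 1)

/-- The class of the variable `X_i` in `O(n; 1)`. -/
def oX (i : Fin n) : O K p n := Ideal.Quotient.mk (truncIdeal K p n) (MvPolynomial.X i)

theorem oX_pow (i : Fin n) : oX K p i ^ p = 0 := by
  rw [oX, ← map_pow]
  exact Ideal.Quotient.eq_zero_iff_mem.2 (Ideal.subset_span ⟨i, rfl⟩)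

theorem ocoeff_omono (β γ : Fin n → Fin p) :
    ocoeff K p β (omono K p γ) = if γ = β then 1 else 0 := by
  classical
  have : expFinsupp p γ = expFinsupp p β ↔ γ = β := by
    refine ⟨fun h => ?_, fun h => by rw [h]⟩
    ext j; simpa [expFinsupp] using DFunLike.congr_fun h j
  rw [omono, ocoeff_mk, MvPolynomial.coeff_monomial]
  simp only [this]

theorem dpow_eq_prod (α : Fin n → ℕ) :
    dpow K p α = (∏ j, ((α j)! : K))⁻¹ • ∏ j, oX K p j ^ α j := by
  simp [dpow, oX]

theorem dpow_single_one (k : Fin n) : dpow K p (Pi.single k 1) = oX K p k := by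
  rw [dpow_eq_prod, Finset.prod_eq_one, Finset.prod_eq_single k]
  · simp
  · intro b _ hb; simp [hb]
  · simp
  · intro b _
    by_cases h : b = k
    · subst h; simp
    · simp [h]

theorem dpow_single_two (k : Fin n) : dpow K p (Pi.single k 2) = (2 : K)⁻¹ • oX K p k ^ 2 := by
  rw [dpow_eq_prod, Finset.prod_eq_single k, Finset.prod_eq_single k]
  · simp
  · intro b _ hb; simp [hb]
  · simp
  · intro b _ hb; simp [hb]
  · simp

theorem omono_eq_prod (β : Fin n → Fin p) : omono K p β = ∏ j, oX K p j ^ (β j : ℕ) := by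
  simp only [omono, oX, ← map_pow, ← map_prod]
  congr 1
  rw [MvPolynomial.monomial_eq, Finsupp.prod_fintype _ _ (by simp)]
  simp [expFinsupp]

theorem adjoin_oX : Algebra.adjoin K (Set.range (oX K p (n := n))) = ⊤ := by
  have := (Algebra.map_top (Ideal.Quotient.mkₐ K (truncIdeal K p n))).trans
    ((AlgHom.range_eq_top _).2 (Ideal.Quotient.mkₐ_surjective K _))
  rw [← this, ← MvPolynomial.adjoin_range_X, AlgHom.map_adjoin, ← Set.range_comp]
  rfl

theorem sum_ocoeff_smul (f : O K p n) : ∑ β, ocoeff K p β f • omono K p β = f := by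
  obtain ⟨f, rfl⟩ := Ideal.Quotient.mk_surjective f
  induction f using MvPolynomial.induction_on' with
  | add f g hf hg =>
    simp only [map_add, add_smul, Finset.sum_add_distrib, hf, hg]
  | monomial s c =>
    by_cases hs : ∀ j, s j < p
    · have e : s = expFinsupp p fun j => ⟨s j, hs j⟩ := by ext; simp [expFinsupp]
      have e2 : Ideal.Quotient.mk (truncIdeal K p n) (MvPolynomial.monomial s c) =
          c • omono K p fun j => ⟨s j, hs j⟩ := by
        rw [omono, ← e]
        change _ = Ideal.Quotient.mk (truncIdeal K p n) (c • _)
        rw [MvPolynomial.smul_monomial, smul_eq_mul, mul_one]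
      rw [e2]
      simp only [map_smul, ocoeff_omono, smul_eq_mul]
      rw [Finset.sum_eq_single fun j => ⟨s j, hs j⟩]
      · simp
      · intro b _ hb; rw [if_neg (Ne.symm hb)]; simp
      · simp
    · push Not at hs
      obtain ⟨j, hj⟩ := hs
      have e : Ideal.Quotient.mk (truncIdeal K p n) (MvPolynomial.monomial s c) = 0 := by
        rw [Ideal.Quotient.eq_zero_iff_mem, MvPolynomial.monomial_eq,
          Finsupp.prod_fintype _ _ (by simp), ← Finset.mul_prod_erase _ _ (Finset.mem_univ j)]
        refine Ideal.mul_mem_left _ _ (Ideal.mul_mem_right _ _ ?_)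
        rw [← Nat.add_sub_cancel' hj, pow_add]
        exact Ideal.mul_mem_right _ _ (Ideal.subset_span ⟨j, rfl⟩)
      rw [e]; simp

theorem O_hom_ext {M : Type*} [AddCommGroup M] [Module K M] {f g : O K p n →ₗ[K] M}
    (h : ∀ β, f (omono K p β) = g (omono K p β)) : f = g := by
  refine LinearMap.ext fun y => ?_
  rw [← sum_ocoeff_smul K p y, map_sum, map_sum]
  simp only [map_smul, h]

end TruncatedPolynomials

/-! ### The basis of W(n;1) and the p-th powers of its elements. -/

section Derivations

variable (K : Type*) [Field K] (p : ℕ) {n : ℕ}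

theorem W_ext {v w : W K p n} (h : ∀ j, v (oX K p j) = w (oX K p j)) : v = w :=
  Derivation.ext_of_adjoin_eq_top _ (adjoin_oX K p) (by rintro _ ⟨j, rfl⟩; exact h j)

theorem dpow_coe (β : Fin n → Fin p) :
    dpow K p (fun j => (β j : ℕ)) = (∏ j, (((β j : ℕ))! : K))⁻¹ • omono K p β := by
  rw [dpow_eq_prod, omono_eq_prod]

/-- Each application of w raises divisibility by x_j by one, and x_j^p = 0. -/
theorem pow_eq_zero_of_raises {w : W K p n} (j : Fin n)
    (h : ∀ (s : ℕ) (f : O K p n), oX K p j ^ (s + 1) ∣ w (oX K p j ^ s * f)) :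
    (w : O K p n →ₗ[K] O K p n) ^ p = 0 := by
  have key : ∀ (m : ℕ) (f : O K p n), oX K p j ^ m ∣ ((w : O K p n →ₗ[K] O K p n) ^ m) f := by
    intro m
    induction m with
    | zero => simp
    | succ m ih =>
      intro f
      obtain ⟨g, hg⟩ := ih f
      rw [pow_succ' (w : O K p n →ₗ[K] O K p n), Module.End.mul_apply, hg]
      exact h m g
  refine LinearMap.ext fun f => ?_
  have := key p f
  rw [oX_pow, zero_dvd_iff] at this
  exact this

theorem oX_pow_dvd_dpow {α : Fin n → ℕ} (j : Fin n) : oX K p j ^ α j ∣ dpow K p α := by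
  obtain ⟨c, hc⟩ := Finset.dvd_prod_of_mem (fun j => oX K p j ^ α j) (Finset.mem_univ j)
  exact ⟨(∏ j, ((α j)! : K))⁻¹ • c, by rw [dpow_eq_prod, hc, mul_smul_comm]⟩

variable [CharP K p]

theorem D_oX (i j : Fin n) : D K p i (oX K p j) = if i = j then 1 else 0 := by
  rw [oX, D_mk, MvPolynomial.pderiv_X]
  by_cases h : i = j
  · subst h; simp
  · simp [h, Ne.symm h]

theorem xD_oX (α : Fin n → ℕ) (i j : Fin n) :
    xD K p α i (oX K p j) = if i = j then dpow K p α else 0 := by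
  rw [xD, Derivation.smul_apply, D_oX]
  split_ifs <;> simp

variable [Fact p.Prime]

theorem factorial_ne_zero {m : ℕ} (hm : m < p) : (m ! : K) ≠ 0 := fun h =>
  absurd (((Fact.out : p.Prime).dvd_factorial).1 ((CharP.cast_eq_zero_iff K p _).1 h))
    (not_le.2 hm)

theorem prod_factorial_ne_zero (β : Fin n → Fin p) : (∏ j, (((β j : ℕ))! : K)) ≠ 0 :=
  Finset.prod_ne_zero_iff.2 fun j _ => factorial_ne_zero K p (β j).2

/-- The basis elements `x^(α) D_i` of `W(n; 1)`. -/
def xDBasis (a : (Fin n → Fin p) × Fin n) : W K p n := xD K p (fun j => (a.1 j : ℕ)) a.2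

/-- A derivation is determined by its values on the variables, so w = Σ w(x_i) D_i; then expand each
w(x_i) in monomials. -/
theorem span_xDBasis : Submodule.span K (Set.range (xDBasis K p (n := n))) = ⊤ := by
  rw [eq_top_iff]
  intro w _
  have e : w = ∑ i, w (oX K p i) • D K p i := by
    refine W_ext K p fun j => ?_
    rw [← Derivation.coeFnAddMonoidHom_apply (∑ i, w (oX K p i) • D K p i), map_sum,
      Finset.sum_apply]
    simp only [Derivation.coeFnAddMonoidHom_apply, Derivation.smul_apply, D_oX]
    simp
  rw [e]
  refine Submodule.sum_mem _ fun i _ => ?_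
  rw [← sum_ocoeff_smul K p (w (oX K p i)), Finset.sum_smul]
  refine Submodule.sum_mem _ fun β _ => ?_
  have : omono K p β • D K p i = (∏ j, (((β j : ℕ))! : K)) • xDBasis K p (β, i) := by
    rw [xDBasis, xD, dpow_coe, smul_assoc, smul_smul,
      mul_inv_cancel₀ (prod_factorial_ne_zero K p β), one_smul]
  rw [smul_assoc, this]
  exact Submodule.smul_mem _ _ (Submodule.smul_mem _ _ (Submodule.subset_span ⟨_, rfl⟩))

/-- Both sides are derivations, so it suffices to compare them on the variables, which are
eigenvectors with eigenvalue 0 or 1. -/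
theorem xD_toral_pow (i : Fin n) : ((xD K p (Pi.single i 1) i : W K p n) : O K p n →ₗ[K] O K p n) ^ p
    = (xD K p (Pi.single i 1) i : W K p n) := by
  have : (xD K p (Pi.single i 1) i : W K p n).powChar p = xD K p (Pi.single i 1) i := by
    refine W_ext K p fun j => ?_
    change (((xD K p (Pi.single i 1) i : W K p n) : O K p n →ₗ[K] O K p n) ^ p) (oX K p j) = _
    have hd := dpow_single_one K p i
    have hit : ∀ m : ℕ, (((xD K p (Pi.single i 1) i : W K p n) : O K p n →ₗ[K] O K p n) ^ (m + 1))
        (oX K p j) = if i = j then oX K p j else 0 := by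
      intro m
      induction m with
      | zero =>
        rw [zero_add, pow_one, Derivation.coeFn_coe, xD_oX, hd]
        split_ifs with h <;> simp [h]
      | succ m ih =>
        rw [pow_succ', Module.End.mul_apply, ih, Derivation.coeFn_coe]
        split_ifs with h
        · rw [xD_oX, hd, h, if_pos rfl]
        · simp
    obtain ⟨m, hm⟩ := Nat.exists_eq_succ_of_ne_zero (Fact.out : p.Prime).ne_zero
    have := hit m
    rw [show m + 1 = p by omega] at this
    rw [this, xD_oX, hd]
    split_ifs with h <;> simp [h]
  exact congrArg (fun v : W K p n => (v : O K p n →ₗ[K] O K p n)) this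

/-- If some α_j ≥ 1 with j ≠ i, the operator raises divisibility by x_j, since D_i kills x_j. If α_i
≥ 2 it raises divisibility by x_i. Otherwise α = 0, and D_i^p is a derivation killing every
variable. -/
theorem xD_nil_pow (α : Fin n → ℕ) (i : Fin n) (hne : α ≠ Pi.single i 1) :
    ((xD K p α i : W K p n) : O K p n →ₗ[K] O K p n) ^ p = 0 := by
  by_cases h : ∃ j, j ≠ i ∧ 1 ≤ α j
  · obtain ⟨j, hji, hj⟩ := h
    refine pow_eq_zero_of_raises K p j fun s f => ?_
    have h0 : xD K p α i (oX K p j) = 0 := by rw [xD_oX, if_neg (Ne.symm hji)]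
    have h1 : xD K p α i (oX K p j ^ s) = 0 := by
      rw [Derivation.leibniz_pow, h0, smul_zero, smul_zero]
    rw [Derivation.leibniz, h1, smul_zero, add_zero, smul_eq_mul, pow_succ]
    refine mul_dvd_mul_left _ ?_
    rw [xD, Derivation.smul_apply, smul_eq_mul]
    exact Dvd.dvd.mul_right ((dvd_pow_self (oX K p j) (Nat.one_le_iff_ne_zero.1 hj)).trans
      (oX_pow_dvd_dpow K p j)) _
  push Not at h
  have h0 : ∀ j, j ≠ i → α j = 0 := fun j hj => by have := h j hj; omega
  by_cases hi : 2 ≤ α i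
  · refine pow_eq_zero_of_raises K p i fun s f => ?_
    have hd : oX K p i ^ 2 ∣ dpow K p α := (pow_dvd_pow _ hi).trans (oX_pow_dvd_dpow K p i)
    rw [Derivation.leibniz, Derivation.leibniz_pow, xD_oX, if_pos rfl]
    refine dvd_add ?_ ?_
    · rw [smul_eq_mul, pow_succ]
      refine mul_dvd_mul_left _ ?_
      rw [xD, Derivation.smul_apply, smul_eq_mul]
      exact Dvd.dvd.mul_right ((dvd_pow_self _ two_ne_zero).trans hd) _
    · rcases s with _ | s
      · simp
      · rw [smul_eq_mul, nsmul_eq_mul, smul_eq_mul]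
        refine Dvd.dvd.mul_left (Dvd.dvd.mul_left ?_ _) _
        rw [Nat.add_sub_cancel, show s + 1 + 1 = s + 2 by ring, pow_add]
        exact mul_dvd_mul_left _ hd
  · have hi1 : α i ≠ 1 := by
      intro h1
      refine hne (funext fun j => ?_)
      by_cases hj : j = i
      · subst hj; simp [h1]
      · simp [hj, h0 j hj]
    have hα : α = 0 := by
      funext j
      by_cases hj : j = i
      · subst hj; simp; omega
      · exact h0 j hj
    subst hα
    have hd : dpow K p (0 : Fin n → ℕ) = 1 := by simp [dpow_eq_prod]
    have : (xD K p 0 i : W K p n).powChar p = 0 := by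
      refine W_ext K p fun j => ?_
      change (((xD K p 0 i : W K p n) : O K p n →ₗ[K] O K p n) ^ p) (oX K p j) = _
      obtain ⟨m, hm⟩ := Nat.exists_eq_add_of_le (Fact.out : p.Prime).two_le
      have e : ((xD K p 0 i : W K p n) : O K p n →ₗ[K] O K p n) ((xD K p 0 i : W K p n) (oX K p j)) = 0 := by
        rw [xD_oX, hd]; split_ifs <;> simp
      have hit : (((xD K p 0 i : W K p n) : O K p n →ₗ[K] O K p n) ^ (m + 2)) (oX K p j) = 0 := by
        rw [pow_add, Module.End.mul_apply, pow_two, Module.End.mul_apply]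
        exact (congrArg _ e).trans (map_zero _)
      rw [show m + 2 = p by omega] at hit
      exact hit
    exact congrArg (fun v : W K p n => (v : O K p n →ₗ[K] O K p n)) this

end Derivations

/-! ### The base ring K[t]/(t^p - qt). -/

section BaseRing

variable (K : Type*) [Field K] (p : ℕ) [Fact p.Prime] (q : K)

theorem natDegree_basePoly :
    (Polynomial.X ^ p - Polynomial.C q * Polynomial.X : Polynomial K).natDegree = p := by
  have h : (Polynomial.C q * Polynomial.X : Polynomial K).degree <
      (Polynomial.X ^ p : Polynomial K).degree := by
    rw [Polynomial.degree_X_pow]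
    refine (Polynomial.degree_C_mul_X_le q).trans_lt ?_
    exact_mod_cast (Fact.out : p.Prime).one_lt
  exact Polynomial.natDegree_eq_of_degree_eq_some
    ((Polynomial.degree_sub_eq_left_of_degree_lt h).trans (Polynomial.degree_X_pow p))

theorem monic_basePoly :
    (Polynomial.X ^ p - Polynomial.C q * Polynomial.X : Polynomial K).Monic :=
  Polynomial.monic_X_pow_sub ((Polynomial.degree_C_mul_X_le q).trans_lt (by
    exact_mod_cast (Fact.out : p.Prime).one_lt))

theorem nontrivial_baseRing : Nontrivial (BaseRing K p q) :=
  AdjoinRoot.nontrivial _ fun h => (Fact.out : p.Prime).ne_zero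
    ((natDegree_basePoly K p q).symm.trans (Polynomial.natDegree_eq_zero_iff_degree_le_zero.2 h.le))

theorem charP_baseRing [CharP K p] : CharP (BaseRing K p q) p := by
  have := nontrivial_baseRing K p q
  exact charP_of_injective_algebraMap (algebraMap K (BaseRing K p q)).injective p

theorem t_ne_zero : t K p q ≠ 0 := by
  refine AdjoinRoot.mk_ne_zero_of_natDegree_lt (monic_basePoly K p q) Polynomial.X_ne_zero ?_
  rw [natDegree_basePoly, Polynomial.natDegree_X]
  exact (Fact.out : p.Prime).one_lt

end BaseRing

/-! ### Universal property of the restricted enveloping algebra. -/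

section RestrictedEnveloping

attribute [local instance] LieRing.ofAssociativeRing

variable (K : Type*) [Field K] (p : ℕ) {n : ℕ} [CharP K p]

/-- The canonical map from `W(n; 1)` to its restricted enveloping algebra. -/
def toU : W K p n →ₗ[K] RestrictedU K p n :=
  (RingQuot.mkAlgHom K (PRel K p n)).toLinearMap ∘ₗ
    (UniversalEnvelopingAlgebra.ι K : W K p n →ₗ⁅K⁆ _).toLinearMap

theorem toU_apply (w : W K p n) :
    toU K p w = RingQuot.mkAlgHom K (PRel K p n) (UniversalEnvelopingAlgebra.ι K w) := rfl

theorem toU_lie (v w : W K p n) : toU K p ⁅v, w⁆ = toU K p v * toU K p w - toU K p w * toU K p v := by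
  rw [toU_apply, LieHom.map_lie, LieRing.of_associative_ring_bracket, map_sub, map_mul, map_mul]
  rfl

theorem toU_toral (i : Fin n) : toU K p (xD K p (Pi.single i 1) i) ^ p =
    toU K p (xD K p (Pi.single i 1) i) := by
  rw [toU_apply, ← map_pow]
  exact RingQuot.mkAlgHom_rel K (PRel.toral i)

theorem toU_nil (α : Fin n → ℕ) (i : Fin n) (hα : ∀ j, α j < p) (hne : α ≠ Pi.single i 1) :
    toU K p (xD K p α i) ^ p = 0 := by
  rw [toU_apply, ← map_pow, RingQuot.mkAlgHom_rel K (PRel.nil α i hα hne), map_zero]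

/-- The universal property of the restricted enveloping algebra. -/
theorem exists_lift_restrictedU {B : Type*} [Ring B] [Algebra K B] (f : W K p n →ₗ[K] B)
    (hlie : ∀ v w, f ⁅v, w⁆ = f v * f w - f w * f v)
    (htoral : ∀ i, f (xD K p (Pi.single i 1) i) ^ p = f (xD K p (Pi.single i 1) i))
    (hnil : ∀ (α : Fin n → ℕ) (i : Fin n), (∀ j, α j < p) → α ≠ Pi.single i 1 →
      f (xD K p α i) ^ p = 0) :
    ∃ F : RestrictedU K p n →ₐ[K] B, ∀ w, F (toU K p w) = f w := by
  let g : W K p n →ₗ⁅K⁆ B := { f with map_lie' := fun {v w} => hlie v w }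
  have hg : ∀ w, UniversalEnvelopingAlgebra.lift K g (UniversalEnvelopingAlgebra.ι K w) = f w :=
    fun w => UniversalEnvelopingAlgebra.lift_ι_apply K g w
  refine ⟨RingQuot.liftAlgHom K ⟨UniversalEnvelopingAlgebra.lift K g, ?_⟩, fun w => ?_⟩
  · rintro x y (⟨i⟩ | ⟨α, i, hα, hne⟩)
    · rw [map_pow, hg, htoral]
    · rw [map_pow, hg, hnil α i hα hne, map_zero]
  · rw [toU_apply, RingQuot.liftAlgHom_mkAlgHom_apply, hg]

theorem restrictedU_hom_ext {B : Type*} [Ring B] [Algebra K B] {F G : RestrictedU K p n →ₐ[K] B}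
    (h : ∀ w, F (toU K p w) = G (toU K p w)) : F = G := by
  refine RingQuot.ringQuot_ext' K F G (UniversalEnvelopingAlgebra.hom_ext K (LieHom.ext fun w => ?_))
  exact h w

/-- The canonical map lifts to a homomorphism into the generated subalgebra; followed by the
inclusion it is the identity by uniqueness. -/
theorem adjoin_toU : Algebra.adjoin K (Set.range (toU K p (n := n))) = ⊤ := by
  set S := Algebra.adjoin K (Set.range (toU K p (n := n))) with hS
  have hmem : ∀ w, toU K p w ∈ S := fun w => Algebra.subset_adjoin ⟨w, rfl⟩
  obtain ⟨F, hF⟩ := exists_lift_restrictedU K p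
    (B := S) (LinearMap.codRestrict S.toSubmodule (toU K p (n := n)) hmem)
    (fun v w => Subtype.ext (toU_lie K p v w)) (fun i => Subtype.ext (toU_toral K p i))
    (fun α i hα hne => Subtype.ext (toU_nil K p α i hα hne))
  have : S.val.comp F = AlgHom.id K _ := restrictedU_hom_ext K p fun w => by
    rw [AlgHom.comp_apply, hF]; rfl
  rw [eq_top_iff]
  intro y _
  have := DFunLike.congr_fun this y
  rw [AlgHom.comp_apply, AlgHom.id_apply] at this
  rw [← this]
  exact (F y).2

end RestrictedEnveloping

/-! ### Action on functions on End O(n;1), and the dimension. -/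

section GenericPointAction

open MvPolynomial

variable (K : Type*) [Field K] (p : ℕ) {n : ℕ}

/-- The coordinate ring of the space of linear endomorphisms of `O(n; 1)`. -/
abbrev EndCoord (K : Type*) [Field K] (p n : ℕ) : Type _ :=
  MvPolynomial ((Fin n → Fin p) × (Fin n → Fin p)) K

/-- The coordinate functions: `genericCoord f γ` sends an endomorphism `u` to the coefficient of
`u f` at `γ`. -/
def genericCoord (γ : Fin n → Fin p) : O K p n →ₗ[K] EndCoord K p n :=
  ∑ β, (ocoeff K p β).smulRight (X (β, γ))

theorem genericCoord_omono (β γ : Fin n → Fin p) :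
    genericCoord K p γ (omono K p β) = X (β, γ) := by
  rw [genericCoord, LinearMap.sum_apply, Finset.sum_eq_single β]
  · rw [LinearMap.smulRight_apply, ocoeff_omono, if_pos rfl, one_smul]
  · intro b _ hb
    rw [LinearMap.smulRight_apply, ocoeff_omono, if_neg (Ne.symm hb), zero_smul]
  · simp

/-- The action of `W(n; 1)` on the coordinate ring by derivations. -/
def coordDeriv : W K p n →ₗ[K] Derivation K (EndCoord K p n) (EndCoord K p n) where
  toFun w := mkDerivation K fun b => genericCoord K p b.2 (w (omono K p b.1))
  map_add' v w := derivation_ext fun b => by simp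
  map_smul' c w := derivation_ext fun b => by simp

/-- The derivation is the infinitesimal right translation u ↦ u ∘ w. Hence on linear coordinates it
reproduces the action of w on O(n;1), and brackets and p-th powers can be compared there. -/
theorem coordDeriv_genericCoord (w : W K p n) (γ : Fin n → Fin p) (f : O K p n) :
    coordDeriv K p w (genericCoord K p γ f) = genericCoord K p γ (w f) := by
  have : (coordDeriv K p w : EndCoord K p n →ₗ[K] EndCoord K p n) ∘ₗ genericCoord K p γ =
      genericCoord K p γ ∘ₗ (w : O K p n →ₗ[K] O K p n) := by
    refine O_hom_ext K p fun β => ?_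
    rw [LinearMap.comp_apply, genericCoord_omono, Derivation.coeFn_coe]
    exact mkDerivation_X _ _ _
  exact DFunLike.congr_fun this f

theorem coordDeriv_pow_genericCoord (w : W K p n) (γ : Fin n → Fin p) (f : O K p n) (m : ℕ) :
    ((coordDeriv K p w : EndCoord K p n →ₗ[K] EndCoord K p n) ^ m) (genericCoord K p γ f) =
      genericCoord K p γ (((w : O K p n →ₗ[K] O K p n) ^ m) f) := by
  induction m with
  | zero => simp
  | succ m ih =>
    rw [pow_succ', Module.End.mul_apply, ih, Derivation.coeFn_coe, coordDeriv_genericCoord,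
      pow_succ', Module.End.mul_apply]
    rfl

theorem coordDeriv_ext {v w : Derivation K (EndCoord K p n) (EndCoord K p n)}
    (h : ∀ γ f, v (genericCoord K p γ f) = w (genericCoord K p γ f)) : v = w :=
  derivation_ext fun b => by rw [← genericCoord_omono]; exact h _ _

theorem coordDeriv_lie (v w : W K p n) :
    coordDeriv K p ⁅v, w⁆ = ⁅coordDeriv K p v, coordDeriv K p w⁆ :=
  coordDeriv_ext K p fun γ f => by
    simp only [Derivation.commutator_apply, coordDeriv_genericCoord, map_sub]

/-- The identity endomorphism as a point of the coordinate ring. -/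
def identityPoint : EndCoord K p n →ₐ[K] K := aeval fun b => if b.1 = b.2 then 1 else 0

theorem identityPoint_genericCoord (γ : Fin n → Fin p) (f : O K p n) :
    identityPoint K p (genericCoord K p γ f) = ocoeff K p γ f := by
  have : (identityPoint K p).toLinearMap ∘ₗ genericCoord K p γ = ocoeff K p γ (n := n) := by
    refine O_hom_ext K p fun β => ?_
    rw [LinearMap.comp_apply, genericCoord_omono, ocoeff_omono]
    exact aeval_X _ _
  exact DFunLike.congr_fun this f

variable [CharP K p] [Fact p.Prime]

/-- The p-th power of a derivation is a derivation, hence determined on linear coordinates, where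
the restricted relations are those already known on O(n;1). -/
theorem exists_coordRep : ∃ ρ : RestrictedU K p n →ₐ[K] Module.End K (EndCoord K p n),
    ∀ w, ρ (toU K p w) = (coordDeriv K p w : EndCoord K p n →ₗ[K] EndCoord K p n) := by
  refine exists_lift_restrictedU K p (n := n)
    { toFun := fun w => (coordDeriv K p w : EndCoord K p n →ₗ[K] EndCoord K p n)
      map_add' := fun v w => by rw [map_add]; rfl
      map_smul' := fun c w => by rw [map_smul]; rfl } ?_ ?_ ?_
  · intro v w
    change ((coordDeriv K p ⁅v, w⁆ : Derivation K _ _) : EndCoord K p n →ₗ[K] EndCoord K p n) = _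
    rw [coordDeriv_lie, Derivation.commutator_coe_linear_map]
    rfl
  · intro i
    have : (coordDeriv K p (xD K p (Pi.single i 1) i : W K p n)).powChar p =
        coordDeriv K p (xD K p (Pi.single i 1) i) := coordDeriv_ext K p fun γ f => by
      refine (coordDeriv_pow_genericCoord K p _ γ f p).trans ?_
      rw [xD_toral_pow, coordDeriv_genericCoord]
      rfl
    exact congrArg (fun v : Derivation K _ _ => (v : EndCoord K p n →ₗ[K] EndCoord K p n)) this
  · intro α i _ hne
    have : (coordDeriv K p (xD K p α i : W K p n)).powChar p = 0 := coordDeriv_ext K p fun γ f => by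
      refine (coordDeriv_pow_genericCoord K p _ γ f p).trans ?_
      rw [xD_nil_pow K p α i hne, LinearMap.zero_apply, map_zero]
      rfl
    exact congrArg (fun v : Derivation K _ _ => (v : EndCoord K p n →ₗ[K] EndCoord K p n)) this

/-- At the identity, x^(β) D_j differentiates the coefficient of x^γ in u(x_i) to the coefficient of
x^γ in x^(β) D_j x_i, which is 1/γ! if (β, j) = (γ, i) and 0 otherwise. The factor γ! normalises
this to a dual frame. -/
theorem coordDeriv_localFrame : LocalFrame (identityPoint K p (n := n))
    (fun a => coordDeriv K p (xDBasis K p a))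
    (fun a : (Fin n → Fin p) × Fin n => (∏ j, (((a.1 j : ℕ))! : K)) • (genericCoord K p a.1 (oX K p a.2) -
      algebraMap K _ (ocoeff K p a.1 (oX K p a.2)))) := by
  have key : ∀ a b : (Fin n → Fin p) × Fin n, identityPoint K p (coordDeriv K p (xDBasis K p a)
      ((∏ j, (((b.1 j : ℕ))! : K)) • (genericCoord K p b.1 (oX K p b.2) -
      algebraMap K _ (ocoeff K p b.1 (oX K p b.2))))) =
      if a.2 = b.2 then (if a.1 = b.1 then 1 else 0) else (0 : K) := by
    intro a b
    rw [Derivation.map_smul, map_sub, Derivation.map_algebraMap, sub_zero, map_smul,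
      coordDeriv_genericCoord, identityPoint_genericCoord, xDBasis, xD_oX]
    split_ifs with h h'
    · rw [dpow_coe, map_smul, ocoeff_omono, if_pos h', h', smul_eq_mul, smul_eq_mul, mul_one,
        mul_inv_cancel₀ (prod_factorial_ne_zero K p _)]
    · rw [dpow_coe, map_smul, ocoeff_omono, if_neg h', smul_zero, smul_zero]
    · rw [map_zero, smul_zero]
  refine ⟨fun a => ?_, fun a b hab => ?_, fun a => ?_⟩
  · rw [map_smul, map_sub, identityPoint_genericCoord, AlgHom.commutes]
    simp
  · rw [key]
    split_ifs with h h'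
    · exact absurd (Prod.ext h' h) hab
    · rfl
    · rfl
  · rw [key, if_pos rfl, if_pos rfl]

theorem span_range_toU_xDBasis :
    Submodule.span K (Set.range fun a => toU K p (xDBasis K p a)) =
      LinearMap.range (toU K p (n := n)) := by
  rw [LinearMap.range_eq_map, ← span_xDBasis, Submodule.map_span, ← Set.range_comp]
  rfl

theorem exists_basis_restrictedU :
    Nonempty (Module.Basis ((Fin n → Fin p) × Fin n → Fin p) K (RestrictedU K p n)) := by
  obtain ⟨ρ, hρ⟩ := exists_coordRep K p (n := n)
  have hmem : ∀ w, toU K p w ∈ Submodule.span K (Set.range fun a => toU K p (xDBasis K p (n := n) a)) :=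
    fun w => by rw [span_range_toU_xDBasis]; exact ⟨w, rfl⟩
  refine ⟨Module.Basis.mk ((coordDeriv_localFrame K p).linearIndependent_orderedMonomials ρ
    (fun a => toU K p (xDBasis K p a)) fun a => hρ _) ?_⟩
  refine (span_orderedMonomials (Fact.out : p.Prime).two_le _ ?_ ?_ ?_).ge
  · rw [← Algebra.adjoin_span, span_range_toU_xDBasis, LinearMap.coe_range, adjoin_toU]
  · intro a b
    rw [← toU_lie]
    exact hmem _
  · rintro ⟨β, i⟩
    by_cases h : (fun j => (β j : ℕ)) = Pi.single i 1
    · rw [xDBasis, h, toU_toral]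
      exact hmem _
    · rw [xDBasis, toU_nil K p _ i (fun j => (β j).2) h]
      exact zero_mem _

theorem finite_finrank_Utq (q : K) : Module.Finite K (Utq K p n q) ∧
    Module.finrank K (Utq K p n q) = p ^ (1 + n * p ^ n) := by
  obtain ⟨b⟩ := exists_basis_restrictedU K p (n := n)
  let pb := AdjoinRoot.powerBasis' (monic_basePoly K p q)
  have hfin := pb.finite
  have hb := Module.Finite.of_basis b
  have h1 : Module.finrank K (BaseRing K p q) = p := by
    rw [pb.finrank]; exact natDegree_basePoly K p q
  have h2 : Module.finrank K (RestrictedU K p n) = p ^ (n * p ^ n) := by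
    rw [Module.finrank_eq_card_basis b]
    simp [mul_comm]
  refine ⟨inferInstance, ?_⟩
  rw [Module.finrank_tensorProduct, h1, h2, pow_add, pow_one]

end GenericPointAction

/-! ### Rising and falling factorials. -/

section Factorials

variable {A B : Type*} [Ring A] [Ring B]

/-- The falling factorial `x (x - 1) ⋯ (x - m + 1)`. -/
def falling (x : A) : ℕ → A
  | 0 => 1
  | m + 1 => falling x m * (x - (m : A))

theorem rising_succ_left (x a : A) (m : ℕ) :
    rising x a (m + 1) = (x + a) * rising x (a + 1) m := by
  induction m with
  | zero => simp [rising]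
  | succ m ih =>
    rw [rising, ih, rising, mul_assoc]
    push_cast
    rw [add_assoc x a, add_assoc x (a + 1), add_assoc a, add_comm (1 : A)]

theorem rising_congr {x a x' a' : A} (h : x + a = x' + a') (m : ℕ) :
    rising x a m = rising x' a' m := by
  induction m with
  | zero => rfl
  | succ m ih => rw [rising, rising, ih, h]

theorem commute_falling (x : A) (m : ℕ) : Commute x (falling x m) := by
  induction m with
  | zero => exact Commute.one_right x
  | succ m ih => exact ih.mul_right ((Commute.refl x).sub_right (Nat.cast_commute m x).symm)

theorem rising_sub_eq_falling (x : A) (m : ℕ) : rising (x - (m : A)) 1 m = falling x m := by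
  induction m with
  | zero => rfl
  | succ m ih =>
    rw [rising_succ_left, rising_congr (x' := x - (m : A)) (a' := 1) (by push_cast; abel), ih,
      falling]
    have : x - ((m + 1 : ℕ) : A) + 1 = x - (m : A) := by push_cast; abel
    rw [this]
    exact ((commute_falling x m).sub_left (Nat.cast_commute m _)).eq

theorem neg_one_pow_mul_rising {R : Type*} [CommRing R] (r : R) (m : ℕ) :
    (-1) ^ m * rising r 0 m = falling (-r) m := by
  induction m with
  | zero => simp [rising, falling]
  | succ m ih => rw [rising, falling, ← ih]; ring

theorem falling_natCast {R : Type*} [CommRing R] (k m : ℕ) :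
    falling (k : R) m = (k.descFactorial m : R) := by
  induction m with
  | zero => simp [falling]
  | succ m ih =>
    rw [falling, ih, Nat.descFactorial_succ]
    rcases le_or_gt m k with h | h
    · push_cast [h]; ring
    · simp [Nat.descFactorial_of_lt h]

/-- If `y x = z y` then `y` intertwines the rising factorials of `x` and `z`. -/
theorem mul_rising_of_intertwine {y x z : A} (h : y * x = z * y) (m : ℕ) :
    y * rising x 1 m = rising z 1 m * y := by
  induction m with
  | zero => simp [rising]
  | succ m ih =>
    have : y * (x + 1 + m) = (z + 1 + m) * y := by
      rw [mul_add, mul_add, h, add_mul, add_mul, mul_one, one_mul, (Nat.cast_commute m y).eq]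
    rw [rising, rising, ← mul_assoc, ih, mul_assoc, this, mul_assoc]

end Factorials

/-! ### Spectral projectors of an element with H^p = H. -/

section Idempotents

open Polynomial

variable (R : Type*) {p : ℕ} [CommRing R] [CharP R p]

/-- The embedding of the prime field. -/
abbrev primeCast : ZMod p →+* R := ZMod.castHom (dvd_refl p) R

variable [Fact p.Prime]

/-- The interpolation polynomial of the indicator function of `a` on the prime field. -/
def idemPoly (a : ZMod p) : R[X] :=
  (Lagrange.basis Finset.univ id a).map (primeCast R)

variable {B : Type*} [Ring B] [Algebra R B]

/-- The projector to the eigenvalue `a` of an element `H` with `H ^ p = H`. -/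
def idem (H : B) (a : ZMod p) : B := aeval H (idemPoly R a)

theorem sum_idem (H : B) : ∑ a : ZMod p, idem R H a = 1 := by
  simp only [idem, idemPoly, ← Polynomial.coe_mapRingHom, ← map_sum]
  rw [Lagrange.sum_basis (Set.injOn_id _) Finset.univ_nonempty]
  simp

theorem map_idem {B' : Type*} [Ring B'] [Algebra R B'] (f : B →ₐ[R] B') (H : B) (a : ZMod p) :
    f (idem R H a) = idem R (f H) a := by
  rw [idem, idem, aeval_algHom_apply]

theorem commute_idem (H : B) (a : ZMod p) : Commute H (idem R H a) := by
  have := (Polynomial.commute_X (idemPoly R a)).map (aeval (R := R) H)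
  rwa [aeval_X] at this

theorem eval_idemPoly (a b : ZMod p) :
    (idemPoly R a).eval (primeCast R b) = if a = b then 1 else 0 := by
  rw [idemPoly, eval_map, eval₂_hom]
  by_cases h : a = b
  · subst h
    have := Lagrange.eval_basis_self (v := id) (Set.injOn_id _) (Finset.mem_univ a)
    rw [id] at this
    rw [this, if_pos rfl, map_one]
  · have := Lagrange.eval_basis_of_ne (v := id) h (Finset.mem_univ b)
    rw [id] at this
    rw [this, if_neg h, map_zero]

variable {R} in
-- Over the prime field, X - a times the interpolation polynomial at a is a scalar multiple of ∏_j
-- (X - j) = X^p - X, which vanishes at H.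
theorem mul_idem {H : B} (hH : H ^ p = H) (a : ZMod p) :
    H * idem R H a = primeCast R a • idem R H a := by
  have h1 : (X - C a) * Lagrange.basis Finset.univ id a =
      C (∏ j ∈ Finset.univ.erase a, (a - j))⁻¹ * (X ^ p - X : (ZMod p)[X]) := by
    have hX : (X ^ p - X : (ZMod p)[X]) = ∏ j : ZMod p, (X - C j) := by
      have hp : 1 < p := (Fact.out : p.Prime).one_lt
      have hroots := FiniteField.roots_X_pow_card_sub_X (ZMod p)
      rw [ZMod.card] at hroots
      have hmonic : (X ^ p - X : (ZMod p)[X]).Monic :=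
        monic_X_pow_sub (by rw [degree_X]; exact_mod_cast hp)
      rw [← prod_multiset_X_sub_C_of_monic_of_roots_card_eq hmonic (by
        rw [hroots, FiniteField.X_pow_card_sub_X_natDegree_eq _ hp, Finset.card_val,
          Finset.card_univ, ZMod.card]), hroots]
      rfl
    rw [hX, ← Finset.mul_prod_erase _ _ (Finset.mem_univ a), Lagrange.basis]
    simp only [Lagrange.basisDivisor, Finset.prod_mul_distrib, id, ← map_prod, Finset.prod_inv_distrib]
    ring
  have h2 := congrArg (fun P => aeval H (P.map (primeCast R))) h1
  simp only [Polynomial.map_mul, Polynomial.map_sub, Polynomial.map_pow, map_X, map_C, map_mul,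
    map_sub, map_pow, aeval_X, aeval_C, hH, sub_self, mul_zero] at h2
  rw [sub_mul, sub_eq_zero, ← Algebra.smul_def] at h2
  exact h2

variable {R} in
-- A polynomial in H acts on an eigenvector by its value at the eigenvalue, and the interpolation
-- polynomial takes the values 0 and 1 on the prime field.
theorem idem_mul_of_eigen {H y : B} {b : ZMod p} (h : H * y = primeCast R b • y) (a : ZMod p) :
    idem R H a * y = if a = b then y else 0 := by
  have key : ∀ P : R[X], aeval H P * y = P.eval (primeCast R b) • y := by
    intro P
    induction P using Polynomial.induction_on' with
    | add P Q hP hQ => rw [map_add, add_mul, hP, hQ, eval_add, add_smul]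
    | monomial m c =>
      have hm : H ^ m * y = (primeCast R b) ^ m • y := by
        induction m with
        | zero => simp
        | succ m ih => rw [pow_succ, mul_assoc, h, mul_smul_comm, ih, smul_smul, pow_succ']
      rw [aeval_monomial, mul_assoc, hm, eval_monomial, mul_smul, Algebra.smul_def c]
  rw [idem, key, eval_idemPoly, ite_smul, one_smul, zero_smul]

variable {R} in
theorem idem_mul_idem {H : B} (hH : H ^ p = H) (a b : ZMod p) :
    idem R H a * idem R H b = if a = b then idem R H b else 0 :=
  idem_mul_of_eigen (mul_idem hH b) a

variable {R} in
/-- The projectors of `H` from any decomposition of `1` into eigenvectors. -/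
theorem idem_eq_sum {H : B} {J : Type*} [Fintype J] (y : J → B) (b : J → ZMod p)
    (hsum : ∑ j, y j = 1) (h : ∀ j, H * y j = primeCast R (b j) • y j) (a : ZMod p) :
    idem R H a = ∑ j, if a = b j then y j else 0 := by
  rw [← mul_one (idem R H a), ← hsum, Finset.mul_sum]
  exact Finset.sum_congr rfl fun j _ => idem_mul_of_eigen (h j) a

variable {R} in
theorem eq_of_idem_mul_eq (H : B) {y z : B} (h : ∀ a : ZMod p, idem R H a * y = idem R H a * z) :
    y = z := by
  rw [← one_mul y, ← one_mul z, ← sum_idem R (p := p) H, Finset.sum_mul, Finset.sum_mul]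
  exact Finset.sum_congr rfl fun a _ => h a

variable {R} in
/-- An element of weight `c` shifts the projectors by `c`. -/
theorem mul_idem_of_weight {H x : B} (hH : H ^ p = H) {c : ZMod p}
    (hx : H * x = x * H + primeCast R c • x) (a : ZMod p) :
    x * idem R H a = idem R H (a + c) * x := by
  have h1 : ∀ a, H * (x * idem R H a) = primeCast R (a + c) • (x * idem R H a) := by
    intro a
    rw [← mul_assoc, hx, add_mul, mul_assoc, mul_idem hH, mul_smul_comm, smul_mul_assoc,
      ← add_smul, map_add]
  conv_rhs => rw [← mul_one x, ← sum_idem R (p := p) H, Finset.mul_sum, Finset.mul_sum]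
  rw [Finset.sum_eq_single a]
  · rw [idem_mul_of_eigen (h1 a), if_pos rfl]
  · intro b _ hb
    rw [idem_mul_of_eigen (h1 b), if_neg (fun e => hb (add_right_cancel e).symm)]
  · simp

end Idempotents

/-! ### Powers with exponents in the prime field. -/

section PrimePowers

variable {G : Type*} [Group G] {p : ℕ} [Fact p.Prime]

/-- The power of an element of exponent `p` by a residue class. -/
def residuePow (g : G) (a : ZMod p) : G := g ^ a.val

theorem residuePow_natCast {g : G} (hg : g ^ p = 1) (m : ℕ) :
    residuePow g (m : ZMod p) = g ^ m := by
  rw [residuePow, ZMod.val_natCast, ← pow_eq_pow_mod m hg]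

theorem residuePow_add {g : G} (hg : g ^ p = 1) (a b : ZMod p) :
    residuePow g (a + b) = residuePow g a * residuePow g b := by
  rw [residuePow, ZMod.val_add, ← pow_eq_pow_mod _ hg, pow_add]; rfl

theorem residuePow_zero (g : G) : residuePow g (0 : ZMod p) = 1 := by
  simp [residuePow]

theorem residuePow_one (g : G) : residuePow g (1 : ZMod p) = g := by
  have : Fact (1 < p) := ⟨(Fact.out : p.Prime).one_lt⟩
  simp [residuePow, ZMod.val_one]

theorem residuePow_neg {g : G} (hg : g ^ p = 1) (a : ZMod p) :
    residuePow g (-a) = (residuePow g a)⁻¹ :=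
  eq_inv_of_mul_eq_one_left (by rw [← residuePow_add hg, neg_add_cancel, residuePow_zero])

theorem residuePow_intCast {g : G} (hg : g ^ p = 1) (m : ℤ) :
    residuePow g (m : ZMod p) = g ^ m := by
  obtain ⟨k, rfl | rfl⟩ := m.eq_nat_or_neg
  · rw [Int.cast_natCast, residuePow_natCast hg, zpow_natCast]
  · rw [Int.cast_neg, Int.cast_natCast, residuePow_neg hg, residuePow_natCast hg, zpow_neg,
      zpow_natCast]

end PrimePowers

/-! ### Commutation rules for h, e and the powers of 1 - et. -/

/-- A pair `h`, `e` with `h ^ p = h`, `e ^ p = 0`, `[h, e] = e`, and a deformation parameter `t`. -/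
structure TwistDatum (R A : Type*) [CommRing R] [Ring A] [Algebra R A] (p : ℕ) where
  h : A
  e : A
  t : R
  h_pow : h ^ p = h
  e_pow : e ^ p = 0
  h_mul_e : h * e = e * h + e

namespace TwistDatum

variable {R A : Type*} [CommRing R] [Ring A] [Algebra R A] {p : ℕ} (T : TwistDatum R A p)

/-- The case m = 0 is [h, e] = e with te rewritten as 1 - (1 - te); the rest is induction. -/
theorem h_mul_pow_succ (m : ℕ) : (1 - T.t • T.e) ^ (m + 1) * T.h =
    T.h * (1 - T.t • T.e) ^ (m + 1) - ((m + 1 : ℕ) : A) * (1 - T.t • T.e) ^ (m + 1) +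
      ((m + 1 : ℕ) : A) * (1 - T.t • T.e) ^ m := by
  have h1 : (1 - T.t • T.e) * T.h = T.h * (1 - T.t • T.e) - (1 - T.t • T.e) + 1 := by
    rw [sub_mul, mul_sub, mul_smul_comm, T.h_mul_e, smul_mul_assoc, smul_add]
    simp only [one_mul, mul_one]
    abel
  induction m with
  | zero => simpa using h1
  | succ m ih =>
    have hc := (Nat.cast_commute (m + 1) (1 - T.t • T.e)).eq
    rw [pow_succ' _ (m + 1), mul_assoc, ih, mul_add, mul_sub, ← mul_assoc _ T.h, h1,
      ← mul_assoc, ← mul_assoc, ← hc, mul_assoc, ← pow_succ', mul_assoc, ← pow_succ',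
      Nat.cast_succ (m + 1)]
    simp only [sub_mul, add_mul, one_mul, mul_assoc, ← pow_succ']
    abel

/-- The operator `ad e`. -/
def adE : Module.End R A := LinearMap.mulLeft R T.e - LinearMap.mulRight R T.e

theorem adE_apply (y : A) : T.adE y = T.e * y - y * T.e := rfl

/-- Moving a power of `1 - e t` to the left. -/
theorem mul_pow_one_sub (x : A) (m : ℕ) : x * (1 - T.t • T.e) ^ m =
    ∑ l ∈ Finset.range (m + 1),
      (m.choose l : R) • T.t ^ l • ((1 - T.t • T.e) ^ (m - l) * (T.adE ^ l) x) := by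
  -- Right multiplication is a sum of two commuting operators, so its m-th power is given by the
  -- binomial theorem.
  have h1 : LinearMap.mulRight R (1 - T.t • T.e) =
      T.t • T.adE + LinearMap.mulLeft R (1 - T.t • T.e) := by
    ext y
    simp only [LinearMap.mulRight_apply, LinearMap.add_apply, LinearMap.smul_apply, adE_apply,
      LinearMap.mulLeft_apply, mul_sub, sub_mul, mul_one, one_mul, smul_sub, mul_smul_comm,
      smul_mul_assoc]
    abel
  have hc : Commute (T.t • T.adE) (LinearMap.mulLeft R (1 - T.t • T.e)) := by
    refine Commute.smul_left ?_ _
    ext y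
    simp only [Module.End.mul_apply, adE_apply, LinearMap.mulLeft_apply, mul_sub, sub_mul,
      one_mul, smul_mul_assoc, mul_smul_comm, mul_assoc]
  have h2 := congrArg (fun f : Module.End R A => (f ^ m) x) h1
  simp only [hc.add_pow, LinearMap.pow_mulRight, LinearMap.pow_mulLeft, LinearMap.mulRight_apply,
    LinearMap.sum_apply] at h2
  rw [h2]
  refine Finset.sum_congr rfl fun l _ => ?_
  rw [← LinearMap.pow_mulLeft, (hc.pow_pow l (m - l)).eq, LinearMap.pow_mulLeft, smul_pow,
    ← Nat.cast_comm, ← nsmul_eq_mul, Nat.cast_smul_eq_nsmul]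
  simp only [LinearMap.smul_apply, Module.End.mul_apply, LinearMap.mulLeft_apply, mul_smul_comm]

/-- The datum with the opposite parameter. -/
def neg : TwistDatum R A p := { T with t := -T.t }

theorem neg_neg : T.neg.neg = T := by
  cases T; simp [neg]

variable [CharP R p]

/-- `x` has weight `c` under `ad h`. -/
def IsWeight (c : ZMod p) (x : A) : Prop := T.h * x = x * T.h + primeCast R c • x

variable {T} in
theorem IsWeight.smul {c : ZMod p} {x : A} (hx : T.IsWeight c x) (r : R) : T.IsWeight c (r • x) := by
  unfold IsWeight at hx ⊢
  rw [mul_smul_comm, hx, smul_add, smul_mul_assoc, smul_comm]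

variable [Fact p.Prime]

include T in
-- The Frobenius identity is taken in the commutative ring R[X] and then evaluated at e.
theorem one_sub_pow : (1 - T.t • T.e) ^ p = 1 := by
  have h1 : ((1 : Polynomial R) - Polynomial.C T.t * Polynomial.X) ^ p =
      1 - Polynomial.C T.t ^ p * Polynomial.X ^ p := by
    rw [sub_pow_char, one_pow, mul_pow]
  have h2 := congrArg (Polynomial.aeval T.e) h1
  simp only [map_pow, map_sub, map_one, map_mul, Polynomial.aeval_C, Polynomial.aeval_X, T.e_pow,
    mul_zero, sub_zero] at h2
  rwa [Algebra.smul_def]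

/-- The unit `1 - e t`. -/
def U : Aˣ := Units.ofPowEqOne (1 - T.t • T.e) p T.one_sub_pow (Fact.out : p.Prime).ne_zero

theorem U_pow : T.U ^ p = 1 := Units.ext (by rw [Units.val_pow_eq_pow_val]; exact T.one_sub_pow)

/-- The power of `1 - e t` by a residue class. -/
def P (a : ZMod p) : A := (residuePow T.U a : Aˣ)

theorem P_add (a b : ZMod p) : T.P (a + b) = T.P a * T.P b := by
  rw [P, residuePow_add T.U_pow]; rfl

theorem P_zero : T.P 0 = 1 := by rw [P, residuePow_zero]; rfl

theorem P_one : T.P 1 = 1 - T.t • T.e := by rw [P, residuePow_one]; rfl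

theorem P_natCast (m : ℕ) : T.P m = (1 - T.t • T.e) ^ m := by
  rw [P, residuePow_natCast T.U_pow, Units.val_pow_eq_pow_val]; rfl

theorem P_intCast (m : ℤ) : T.P m = ((T.U ^ m : Aˣ) : A) := by
  rw [P, residuePow_intCast T.U_pow]

theorem P_eq_pow (a : ZMod p) : T.P a = (1 - T.t • T.e) ^ a.val := by
  rw [← P_natCast, ZMod.natCast_zmod_val]

theorem P_mul_P (a b : ZMod p) : T.P a * T.P b = T.P (a + b) := (T.P_add a b).symm

theorem P_neg_mul (a : ZMod p) : T.P (-a) * T.P a = 1 := by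
  rw [P_mul_P, neg_add_cancel, P_zero]

theorem P_mul_neg (a : ZMod p) : T.P a * T.P (-a) = 1 := by
  rw [P_mul_P, add_neg_cancel, P_zero]

theorem commute_e_P (a : ZMod p) : Commute T.e (T.P a) := by
  rw [P_eq_pow]
  exact (((Commute.one_right _).sub_right ((Commute.refl _).smul_right _))).pow_right _

/-- Conjugating `h` by the powers of `1 - e t`. -/
theorem P_mul_h (a : ZMod p) : T.P a * T.h =
    T.h * T.P a - primeCast R a • T.P a + primeCast R a • T.P (a - 1) := by
  obtain ⟨m, hm⟩ : ∃ m : ℕ, a = ((m + 1 : ℕ) : ZMod p) := by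
    refine ⟨(a - 1).val, ?_⟩
    rw [Nat.cast_succ, ZMod.natCast_zmod_val, sub_add_cancel]
  have hm1 : a - 1 = (m : ℕ) := by rw [hm]; push_cast; ring
  rw [hm1, hm, P_natCast, P_natCast, h_mul_pow_succ, map_natCast, Nat.cast_smul_eq_nsmul,
    Nat.cast_smul_eq_nsmul, nsmul_eq_mul, nsmul_eq_mul]

/-- The projectors to the eigenvalues of `h`. -/
def E (a : ZMod p) : A := idem R T.h a

theorem sum_E : ∑ a, T.E a = 1 := sum_idem R T.h

theorem h_mul_E (a : ZMod p) : T.h * T.E a = primeCast R a • T.E a := mul_idem T.h_pow a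

theorem E_mul_h (a : ZMod p) : T.E a * T.h = primeCast R a • T.E a := by
  rw [← T.h_mul_E]; exact (commute_idem R T.h a).eq.symm

theorem E_mul_E (a b : ZMod p) : T.E a * T.E b = if a = b then T.E b else 0 :=
  idem_mul_idem T.h_pow a b

theorem ext_E {y z : A} (h : ∀ a, T.E a * y = T.E a * z) : y = z := eq_of_idem_mul_eq T.h h

variable {T}

theorem IsWeight.mul_E {c : ZMod p} {x : A} (hx : T.IsWeight c x) (a : ZMod p) :
    x * T.E a = T.E (a + c) * x := mul_idem_of_weight T.h_pow hx a

theorem IsWeight.E_mul {c : ZMod p} {x : A} (hx : T.IsWeight c x) (a : ZMod p) :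
    T.E a * x = x * T.E (a - c) := by rw [hx.mul_E, sub_add_cancel]

variable (T)

theorem isWeight_e : T.IsWeight 1 T.e := by
  rw [IsWeight, map_one, one_smul]; exact T.h_mul_e

theorem isWeight_h : T.IsWeight 0 T.h := by
  rw [IsWeight, map_zero, zero_smul, add_zero]

variable {T} in
theorem IsWeight.adE_pow {c : ZMod p} {x : A} (hx : T.IsWeight c x) (m : ℕ) :
    T.IsWeight (c + m) ((T.adE ^ m) x) := by
  induction m with
  | zero => simpa using hx
  | succ m ih =>
    rw [pow_succ', Module.End.mul_apply]
    set y := (T.adE ^ m) x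
    have h1 := T.h_mul_e
    have h2 : primeCast R (c + ((m + 1 : ℕ) : ZMod p)) = primeCast R (c + m) + 1 := by
      rw [Nat.cast_succ, ← add_assoc, map_add _ (c + _), map_one]
    unfold IsWeight at ih ⊢
    rw [adE_apply, mul_sub, ← mul_assoc, h1, ← mul_assoc, ih, h2]
    simp only [add_mul, mul_add, sub_mul, mul_assoc, ih, h1, smul_mul_assoc, mul_smul_comm,
      smul_sub, add_smul, one_smul]
    abel

/-- Moving a power of `1 - e t` to the left, with divided powers of `ad e`. -/
theorem mul_P (x : A) (r : ℕ → R) (hr : ∀ l < p, r l * (l ! : R) = 1) (a : ZMod p) : x * T.P a =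
    ∑ l ∈ Finset.range p, falling (primeCast R a) l •
      T.t ^ l • (T.P (a - l) * (r l • (T.adE ^ l) x)) := by
  have ha : primeCast R a = ((a.val : ℕ) : R) := by
    conv_lhs => rw [← ZMod.natCast_zmod_val a]
    rw [map_natCast]
  have hle : a.val + 1 ≤ p := ZMod.val_lt a
  rw [P_eq_pow, mul_pow_one_sub]
  -- The binomial sum stops at the representative of a, but it may be extended to all l < p because
  -- the falling factorial of a vanishes beyond that point.
  rw [← Finset.sum_subset (Finset.range_mono hle)]
  · refine Finset.sum_congr rfl fun l hl => ?_
    rw [Finset.mem_range] at hl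
    have e1 : a - (l : ZMod p) = ((a.val - l : ℕ) : ZMod p) := by
      rw [Nat.cast_sub (by omega), ZMod.natCast_zmod_val]
    rw [e1, P_natCast, ha, falling_natCast, Nat.descFactorial_eq_factorial_mul_choose, Nat.cast_mul,
      mul_smul_comm, smul_smul, smul_smul, smul_smul]
    congr 1
    linear_combination (-(a.val.choose l : R) * T.t ^ l) * hr l (by omega)
  · intro l hl hl'
    rw [Finset.mem_range, not_lt] at hl'
    rw [ha, falling_natCast, Nat.descFactorial_of_lt hl', Nat.cast_zero, zero_smul]

/-- The twisting element `∑ E a (1 - e t)^a` of the antipode. -/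
def V : A := ∑ a, T.E a * T.P a

theorem E_mul_V (a : ZMod p) : T.E a * T.V = T.E a * T.P a := by
  rw [V, Finset.mul_sum, Finset.sum_eq_single a]
  · rw [← mul_assoc, E_mul_E, if_pos rfl]
  · intro b _ hb
    rw [← mul_assoc, E_mul_E, if_neg (Ne.symm hb), zero_mul]
  · simp

/-- Moving e past E_a shifts the index by one, so e V = V (1-et)⁻¹ e. Substituting te = 1 - (1-et)
gives (1+et) V = V (1-et)⁻¹. -/
theorem neg_P_one_mul_V : T.neg.P 1 * T.V = T.V * T.P (-1) := by
  have he : T.e * T.V = T.V * T.P (-1) * T.e := by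
    rw [V, Finset.mul_sum, Finset.sum_mul, Finset.sum_mul]
    refine Fintype.sum_equiv (Equiv.addRight 1) _ _ fun a => ?_
    rw [← mul_assoc, T.isWeight_e.mul_E, mul_assoc, (T.commute_e_P a).eq]
    change _ = T.E (a + 1) * T.P (a + 1) * T.P (-1) * T.e
    rw [mul_assoc _ (T.P _) (T.P _), P_mul_P, add_neg_cancel_right, mul_assoc]
  have h1 : T.neg.P 1 = 1 + T.t • T.e := by
    rw [P_one]; simp [neg]
  have h2 : T.t • T.e = 1 - T.P 1 := by rw [P_one]; abel
  rw [h1, add_mul, one_mul, smul_mul_assoc, he, ← mul_smul_comm, h2, mul_sub, mul_one,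
    mul_assoc, P_neg_mul, mul_one]
  abel

theorem neg_P_mul_V (a : ZMod p) : T.neg.P a * T.V = T.V * T.P (-a) := by
  have : ∀ m : ℕ, T.neg.P (m : ZMod p) * T.V = T.V * T.P (-(m : ZMod p)) := by
    intro m
    induction m with
    | zero => simp [P_zero]
    | succ m ih =>
      rw [Nat.cast_succ, P_add, mul_assoc, neg_P_one_mul_V, ← mul_assoc, ih, mul_assoc, P_mul_P,
        neg_add]
  rw [← ZMod.natCast_zmod_val a]
  exact this _

theorem neg_V_mul_V : T.neg.V * T.V = 1 := by
  rw [V, Finset.sum_mul, ← T.sum_E]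
  refine Finset.sum_congr rfl fun a _ => ?_
  rw [mul_assoc, neg_P_mul_V, ← mul_assoc]
  change T.E a * T.V * _ = _
  rw [E_mul_V, mul_assoc, P_mul_neg, mul_one]

theorem V_mul_neg_V : T.V * T.neg.V = 1 := by
  have := T.neg.neg_V_mul_V
  rwa [neg_neg] at this

/-- `V` as a unit. -/
def VUnit : Aˣ := ⟨T.V, T.neg.V, T.V_mul_neg_V, T.neg_V_mul_V⟩

theorem E_mul_P_mul_sub (b m : ZMod p) :
    T.E b * T.P m * (T.h - algebraMap R A (primeCast R (b - m))) =
      primeCast R m • (T.E b * T.P (m - 1)) := by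
  rw [mul_sub, mul_assoc, P_mul_h, ← Algebra.commutes, ← Algebra.smul_def, mul_add, mul_sub,
    ← mul_assoc, E_mul_h, mul_smul_comm, mul_smul_comm, map_sub, sub_smul, smul_mul_assoc]
  abel

/-- Scalar falling factorials beside a projector are traded for falling factorials of h, each factor
lowering the exponent of 1 - et by one. -/
theorem E_mul_P_mul_falling (b c : ZMod p) (l : ℕ) :
    T.E b * T.P (b - c) * falling (T.h - algebraMap R A (primeCast R c)) l =
      falling (primeCast R (b - c)) l • (T.E b * T.P (b - c - l)) := by
  induction l with
  | zero => simp [falling]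
  | succ l ih =>
    have e1 : T.h - algebraMap R A (primeCast R c) - (l : A) =
        T.h - algebraMap R A (primeCast R (b - (b - c - (l : ZMod p)))) := by
      rw [show b - (b - c - (l : ZMod p)) = c + l by ring, map_add, map_natCast, map_add,
        map_natCast, sub_sub]
    rw [falling, ← mul_assoc, ih, smul_mul_assoc, e1, E_mul_P_mul_sub, smul_smul, falling,
      Nat.cast_succ, sub_sub _ (l : ZMod p), map_sub _ _ (l : ZMod p), map_natCast]

variable {T} in
/-- The conjugate of a weight vector by `V`. -/
theorem IsWeight.mul_V {c : ZMod p} {x : A} (hx : T.IsWeight c x) (r : ℕ → R)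
    (hr : ∀ l < p, r l * (l ! : R) = 1) :
    x * T.V = T.V * (T.P (-c) * ∑ l ∈ Finset.range p,
      T.t ^ l • ((r l • (T.adE ^ l) x) * rising T.h 1 l)) := by
  -- After projecting by E_b, the element V acts as a single power of 1 - et: E_b x V = E_b x
  -- (1-et)^(b-c), to which the binomial expansion applies.
  refine T.ext_E fun b => ?_
  rw [← mul_assoc, hx.E_mul, mul_assoc, E_mul_V, ← mul_assoc, ← hx.E_mul, mul_assoc,
    T.mul_P x r hr, ← mul_assoc, E_mul_V, ← mul_assoc, mul_assoc (T.E b), P_mul_P,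
    ← sub_eq_add_neg, Finset.mul_sum, Finset.mul_sum]
  refine Finset.sum_congr rfl fun l _ => ?_
  have hw := (hx.adE_pow l).smul (r l)
  set y := r l • (T.adE ^ l) x
  clear_value y
  -- The element y has weight c + l. Moving h^⟨l⟩ with offset 1 across it therefore gives exactly
  -- the falling factorial of h - c.
  have hint : y * T.h = (T.h - algebraMap R A (primeCast R c) - (l : A)) * y := by
    unfold IsWeight at hw
    rw [sub_mul, sub_mul, hw, ← Algebra.smul_def, map_add, map_natCast, add_smul,
      Nat.cast_smul_eq_nsmul, nsmul_eq_mul]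
    abel
  rw [mul_rising_of_intertwine hint, rising_sub_eq_falling, mul_smul_comm, mul_smul_comm,
    mul_smul_comm, ← mul_assoc (T.E b), ← mul_assoc (T.E b * T.P (b - c)), E_mul_P_mul_falling,
    smul_mul_assoc, smul_comm]

end TwistDatum

/-! ### Conjugation, and antipode identities on generators. -/

section Generators

variable {R A : Type*} [CommRing R] [Ring A] [Algebra R A]

/-- Conjugation by a unit. -/
def conjAlgHom (u : Aˣ) : A →ₐ[R] A :=
  AlgHom.ofLinearMap ((LinearMap.mulLeft R (u : A)) ∘ₗ LinearMap.mulRight R ((u⁻¹ : Aˣ) : A))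
    (by simp) (fun x y => by simp [mul_assoc])

theorem conjAlgHom_apply (u : Aˣ) (x : A) :
    conjAlgHom (R := R) u x = u * x * ((u⁻¹ : Aˣ) : A) := by
  simp [conjAlgHom, mul_assoc]

/-- The linear map underlying an anti-homomorphism. -/
def antiLinear (S : A →ₐ[R] Aᵐᵒᵖ) : A →ₗ[R] A :=
  (MulOpposite.opLinearEquiv R).symm.toLinearMap ∘ₗ S.toLinearMap

theorem antiLinear_apply (S : A →ₐ[R] Aᵐᵒᵖ) (x : A) : antiLinear S x = (S x).unop := rfl

theorem antiLinear_mul (S : A →ₐ[R] Aᵐᵒᵖ) (x y : A) :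
    antiLinear S (x * y) = antiLinear S y * antiLinear S x := by
  simp [antiLinear_apply]

/-- The left antipode identity may be checked on generators. -/
theorem antipode_left_of_generators (Δ : A →ₐ[R] A ⊗[R] A) (ε : A →ₐ[R] R) (S : A →ₐ[R] Aᵐᵒᵖ)
    {G : Set A} (hG : Algebra.adjoin R G = ⊤)
    (h : ∀ x ∈ G, LinearMap.mul' R A ((antiLinear S).rTensor A (Δ x)) = algebraMap R A (ε x)) :
    LinearMap.mul' R A ∘ₗ (antiLinear S).rTensor A ∘ₗ Δ.toLinearMap =
      Algebra.linearMap R A ∘ₗ ε.toLinearMap := by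
  set T := LinearMap.mul' R A ∘ₗ (antiLinear S).rTensor A with hT
  -- Anti-multiplicativity nests the contraction of z inside that of w; if the inner one is a scalar
  -- it comes out.
  have hmul : ∀ (z w : A ⊗[R] A) (r : R), T z = algebraMap R A r → T (z * w) = r • T w := by
    intro z w r hz
    have key : ∀ a b, T (z * a ⊗ₜ b) = antiLinear S a * T z * b := by
      intro a b
      clear hz
      induction z with
      | zero => simp
      | tmul c d => simp [hT, antiLinear_mul, mul_assoc]
      | add z z' hz hz' => rw [add_mul, map_add, map_add, hz, hz', mul_add, add_mul]
    induction w with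
    | zero => simp
    | add w w' hw hw' => rw [mul_add, map_add, map_add, hw, hw', smul_add]
    | tmul a b =>
      rw [key, hz, ← Algebra.commutes, mul_assoc, ← Algebra.smul_def]
      simp [hT]
  refine LinearMap.ext fun x => ?_
  change T (Δ x) = algebraMap R A (ε x)
  have hx : x ∈ Algebra.adjoin R G := by rw [hG]; trivial
  induction hx using Algebra.adjoin_induction with
  | mem x hx => exact h x hx
  | algebraMap r =>
    rw [AlgHom.commutes, AlgHom.commutes, Algebra.algebraMap_eq_smul_one, map_smul,
      Algebra.TensorProduct.one_def]
    simp [hT, antiLinear_apply, Algebra.algebraMap_eq_smul_one]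
  | add x y _ _ hx hy => rw [map_add, map_add, hx, hy, map_add, map_add]
  | mul x y _ _ hx hy =>
    rw [map_mul, hmul _ _ _ hx, hy, map_mul, map_mul, Algebra.smul_def]

/-- The right antipode identity may be checked on generators. -/
theorem antipode_right_of_generators (Δ : A →ₐ[R] A ⊗[R] A) (ε : A →ₐ[R] R) (S : A →ₐ[R] Aᵐᵒᵖ)
    {G : Set A} (hG : Algebra.adjoin R G = ⊤)
    (h : ∀ x ∈ G, LinearMap.mul' R A ((antiLinear S).lTensor A (Δ x)) = algebraMap R A (ε x)) :
    LinearMap.mul' R A ∘ₗ (antiLinear S).lTensor A ∘ₗ Δ.toLinearMap =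
      Algebra.linearMap R A ∘ₗ ε.toLinearMap := by
  set T := LinearMap.mul' R A ∘ₗ (antiLinear S).lTensor A with hT
  have hmul : ∀ (z w : A ⊗[R] A) (r : R), T w = algebraMap R A r → T (z * w) = r • T z := by
    intro z w r hw
    have key : ∀ a b, T (a ⊗ₜ b * w) = a * T w * antiLinear S b := by
      intro a b
      clear hw
      induction w with
      | zero => simp
      | tmul c d => simp [hT, antiLinear_mul, mul_assoc]
      | add z z' hz hz' => rw [mul_add, map_add, map_add, hz, hz', mul_add, add_mul]
    induction z with
    | zero => simp
    | add w w' hw hw' => rw [add_mul, map_add, map_add, hw, hw', smul_add]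
    | tmul a b =>
      rw [key, hw, ← Algebra.commutes, mul_assoc, ← Algebra.smul_def]
      simp [hT]
  refine LinearMap.ext fun x => ?_
  change T (Δ x) = algebraMap R A (ε x)
  have hx : x ∈ Algebra.adjoin R G := by rw [hG]; trivial
  induction hx using Algebra.adjoin_induction with
  | mem x hx => exact h x hx
  | algebraMap r =>
    rw [AlgHom.commutes, AlgHom.commutes, Algebra.algebraMap_eq_smul_one, map_smul,
      Algebra.TensorProduct.one_def]
    simp [hT, antiLinear_apply, Algebra.algebraMap_eq_smul_one]
  | add x y _ _ hx hy => rw [map_add, map_add, hx, hy, map_add, map_add]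
  | mul x y _ _ hx hy =>
    rw [map_mul, hmul _ _ _ hy, hx, map_mul, map_mul, Algebra.smul_def, Algebra.commutes]

end Generators

/-- Comultiplication, counit and antipode for which a set of algebra generators is primitive. -/
structure PrimitiveData (R A : Type*) [CommRing R] [Ring A] [Algebra R A] (G : Set A) where
  comul : A →ₐ[R] A ⊗[R] A
  counit : A →ₐ[R] R
  antipode : A →ₐ[R] Aᵐᵒᵖ
  adjoin_eq_top : Algebra.adjoin R G = ⊤
  comul_gen : ∀ x ∈ G, comul x = x ⊗ₜ 1 + 1 ⊗ₜ x
  counit_gen : ∀ x ∈ G, counit x = 0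
  antipode_gen : ∀ x ∈ G, antipode x = MulOpposite.op (-x)

/-! ### The Drinfeld twist and the twisted coproduct. -/

namespace TwistDatum

variable {R A : Type*} [CommRing R] [Ring A] [Algebra R A] {p : ℕ} [Fact p.Prime] [CharP R p]
  (T : TwistDatum R A p)

theorem one_eq_sum_E_tmul : (1 : A ⊗[R] A) = ∑ a, T.E a ⊗ₜ 1 := by
  rw [← TensorProduct.sum_tmul, sum_E, Algebra.TensorProduct.one_def]

/-- The Drinfeld twist `∑ E a ⊗ (1 - e t)^a`. -/
def F : (A ⊗[R] A)ˣ where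
  val := ∑ a, T.E a ⊗ₜ T.P a
  inv := ∑ a, T.E a ⊗ₜ T.P (-a)
  val_inv := by
    rw [Finset.sum_mul_sum, one_eq_sum_E_tmul]
    refine Finset.sum_congr rfl fun a _ => ?_
    rw [Finset.sum_eq_single a]
    · rw [Algebra.TensorProduct.tmul_mul_tmul, E_mul_E, if_pos rfl, P_mul_neg]
    · intro b _ hb
      rw [Algebra.TensorProduct.tmul_mul_tmul, E_mul_E, if_neg (Ne.symm hb), TensorProduct.zero_tmul]
    · simp
  inv_val := by
    rw [Finset.sum_mul_sum, one_eq_sum_E_tmul]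
    refine Finset.sum_congr rfl fun a _ => ?_
    rw [Finset.sum_eq_single a]
    · rw [Algebra.TensorProduct.tmul_mul_tmul, E_mul_E, if_pos rfl, P_neg_mul]
    · intro b _ hb
      rw [Algebra.TensorProduct.tmul_mul_tmul, E_mul_E, if_neg (Ne.symm hb), TensorProduct.zero_tmul]
    · simp

theorem coe_F : (T.F : A ⊗[R] A) = ∑ a, T.E a ⊗ₜ T.P a := rfl

theorem coe_F_inv : ((T.F⁻¹ : (A ⊗[R] A)ˣ) : A ⊗[R] A) = ∑ a, T.E a ⊗ₜ T.P (-a) := rfl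

/-- Orthogonality of the projectors reduces F to its a-th summand on E_a ⊗ A. -/
theorem conj_E_tmul (a : ZMod p) (y : A) :
    conjAlgHom (R := R) T.F (T.E a ⊗ₜ y) = T.E a ⊗ₜ (T.P a * y * T.P (-a)) := by
  have h1 : (T.F : A ⊗[R] A) * (T.E a ⊗ₜ y) = T.E a ⊗ₜ (T.P a * y) := by
    rw [coe_F, Finset.sum_mul, Finset.sum_eq_single a]
    · rw [Algebra.TensorProduct.tmul_mul_tmul, E_mul_E, if_pos rfl]
    · intro b _ hb
      rw [Algebra.TensorProduct.tmul_mul_tmul, E_mul_E, if_neg hb, TensorProduct.zero_tmul]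
    · simp
  rw [conjAlgHom_apply, h1, coe_F_inv, Finset.mul_sum, Finset.sum_eq_single a]
  · rw [Algebra.TensorProduct.tmul_mul_tmul, E_mul_E, if_pos rfl]
  · intro b _ hb
    rw [Algebra.TensorProduct.tmul_mul_tmul, E_mul_E, if_neg (Ne.symm hb), TensorProduct.zero_tmul]
  · simp

theorem conj_one_tmul (y : A) : conjAlgHom (R := R) T.F (1 ⊗ₜ y) =
    ∑ a, T.E a ⊗ₜ (T.P a * y * T.P (-a)) := by
  rw [← T.sum_E, TensorProduct.sum_tmul, map_sum]
  exact Finset.sum_congr rfl fun a _ => T.conj_E_tmul a y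

variable {T} in
-- Passing x shifts the projector index by c, so the powers of 1 - et on the two sides differ by the
-- factor with exponent c.
theorem IsWeight.conj_tmul_one {c : ZMod p} {x : A} (hx : T.IsWeight c x) :
    conjAlgHom (R := R) T.F (x ⊗ₜ 1) = x ⊗ₜ T.P c := by
  rw [conjAlgHom_apply, Units.mul_inv_eq_iff_eq_mul, coe_F, Finset.sum_mul, Finset.mul_sum]
  refine Fintype.sum_equiv (Equiv.subRight c) _ _ fun a => ?_
  change _ = x ⊗ₜ T.P c * T.E (a - c) ⊗ₜ[R] T.P (a - c)
  rw [Algebra.TensorProduct.tmul_mul_tmul, Algebra.TensorProduct.tmul_mul_tmul, P_mul_P, mul_one,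
    add_sub_cancel, hx.E_mul]

variable {G : Set A} (D : PrimitiveData R A G)

/-- The twisted comultiplication. -/
def comul : A →ₐ[R] A ⊗[R] A := (conjAlgHom T.F).comp D.comul

theorem comul_apply (x : A) : T.comul D x =
    conjAlgHom (R := R) T.F (D.comul x) := rfl

variable {T} in
theorem IsWeight.comul_eq {c : ZMod p} {x : A} (hx : T.IsWeight c x) (hG : x ∈ G) :
    T.comul D x = x ⊗ₜ T.P c + ∑ a, T.E a ⊗ₜ (T.P a * x * T.P (-a)) := by
  rw [comul_apply, D.comul_gen x hG, map_add, hx.conj_tmul_one, conj_one_tmul]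

variable {T} in
/-- The closed formula for the twisted comultiplication of a weight vector. -/
theorem IsWeight.comul_formula {c : ZMod p} {x : A} (hx : T.IsWeight c x) (hG : x ∈ G) (r : ℕ → R)
    (hr : ∀ l < p, r l * (l ! : R) = 1) :
    T.comul D x = x ⊗ₜ T.P c + ∑ l ∈ Finset.range p, (-1 : R) ^ l •
      (rising T.h 0 l ⊗ₜ[R] (T.t ^ l • (T.P (-l) * (r l • (T.adE ^ l) x)))) := by
  rw [hx.comul_eq D hG]
  congr 1
  have h1 : ∀ a, T.P a * x * T.P (-a) = ∑ l ∈ Finset.range p, ((-1 : R) ^ l *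
      rising (primeCast R a) 0 l) • T.t ^ l • (T.P (-l) * (r l • (T.adE ^ l) x)) := by
    intro a
    rw [mul_assoc, T.mul_P x r hr, Finset.mul_sum]
    refine Finset.sum_congr rfl fun l _ => ?_
    rw [mul_smul_comm, mul_smul_comm, ← mul_assoc, P_mul_P, neg_one_pow_mul_rising, ← map_neg]
    congr 4
    ring
  -- Summed over a, this assembles the scalar rising factorials into the rising factorial of h.
  have h2 : ∀ a l, T.E a * rising T.h 0 l = rising (primeCast R a) 0 l • T.E a := by
    intro a l
    induction l with
    | zero => simp [rising]
    | succ l ih =>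
      rw [rising, rising, ← mul_assoc, ih, smul_mul_assoc, add_zero, add_zero, mul_add, E_mul_h,
        ← Nat.cast_comm, ← nsmul_eq_mul, ← Nat.cast_smul_eq_nsmul R, ← add_smul, smul_smul]
  simp only [h1, TensorProduct.tmul_sum]
  rw [Finset.sum_comm]
  refine Finset.sum_congr rfl fun l _ => ?_
  conv_rhs => rw [← one_mul (rising T.h 0 l), ← T.sum_E, Finset.sum_mul, TensorProduct.sum_tmul,
    Finset.smul_sum]
  refine Finset.sum_congr rfl fun a _ => ?_
  rw [h2, ← TensorProduct.smul_tmul', TensorProduct.tmul_smul, smul_smul]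

/-- Since e commutes with 1 - et, its twisted coproduct is e ⊗ (1-et) + 1 ⊗ e, which makes 1 - et
grouplike. -/
theorem comul_P (he : T.e ∈ G) (a : ZMod p) : T.comul D (T.P a) = T.P a ⊗ₜ T.P a := by
  have h1 : ∀ a, T.P a * T.e * T.P (-a) = T.e := fun a => by
    rw [← (T.commute_e_P a).eq, mul_assoc, P_mul_neg, mul_one]
  have h2 : T.comul D T.e = T.e ⊗ₜ T.P 1 + 1 ⊗ₜ T.e := by
    rw [T.isWeight_e.comul_eq D he]
    simp only [h1]
    rw [← TensorProduct.sum_tmul, sum_E]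
  have h3 : T.comul D (1 - T.t • T.e) = (1 - T.t • T.e) ⊗ₜ (1 - T.t • T.e) := by
    rw [map_sub, map_one, map_smul, h2, P_one]
    simp only [TensorProduct.tmul_sub, TensorProduct.sub_tmul, TensorProduct.tmul_smul,
      ← TensorProduct.smul_tmul', smul_add, smul_sub, Algebra.TensorProduct.one_def]
    abel
  rw [P_eq_pow, map_pow, h3, Algebra.TensorProduct.tmul_pow]

theorem counit_P (he : T.e ∈ G) (a : ZMod p) : D.counit (T.P a) = 1 := by
  rw [P_eq_pow, map_pow, map_sub, map_smul, D.counit_gen _ he]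
  simp

/-- Before twisting, E_a ⊗ E_b is an eigenvector of h ⊗ 1 + 1 ⊗ h with eigenvalue a + b, so E_s goes
to the sum over a + b = s. -/
theorem comul_E (hh : T.h ∈ G) (s : ZMod p) : T.comul D (T.E s) =
    ∑ a, T.E a ⊗ₜ (T.P a * T.E (s - a) * T.P (-a)) := by
  have h1 : D.comul (T.E s) = ∑ a, T.E a ⊗ₜ T.E (s - a) := by
    rw [E, map_idem, D.comul_gen _ hh, idem_eq_sum (fun ab : ZMod p × ZMod p => T.E ab.1 ⊗ₜ T.E ab.2)
      (fun ab => ab.1 + ab.2), Fintype.sum_prod_type]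
    · refine Finset.sum_congr rfl fun a _ => ?_
      rw [Finset.sum_eq_single (s - a)]
      · rw [add_sub_cancel, if_pos rfl]
      · intro b _ hb
        rw [if_neg]
        rintro rfl
        exact hb (by simp)
      · simp
    · rw [Fintype.sum_prod_type, Algebra.TensorProduct.one_def]
      simp only [← TensorProduct.tmul_sum, sum_E]
      rw [← TensorProduct.sum_tmul, sum_E]
    · rintro ⟨a, b⟩
      rw [add_mul, Algebra.TensorProduct.tmul_mul_tmul, Algebra.TensorProduct.tmul_mul_tmul,
        one_mul, one_mul, h_mul_E, h_mul_E, TensorProduct.tmul_smul, ← TensorProduct.smul_tmul',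
        ← add_smul, map_add]
  rw [comul_apply, h1, map_sum]
  exact Finset.sum_congr rfl fun a _ => T.conj_E_tmul a _

theorem counit_E (hh : T.h ∈ G) (a : ZMod p) : D.counit (T.E a) = if a = 0 then 1 else 0 := by
  rw [E, map_idem, D.counit_gen _ hh, ← mul_one (idem R (0 : R) a)]
  exact idem_mul_of_eigen (by simp) a

theorem antipode_E (hh : T.h ∈ G) (a : ZMod p) : D.antipode (T.E a) = MulOpposite.op (T.E (-a)) := by
  rw [E, map_idem, D.antipode_gen _ hh, idem_eq_sum (fun b => MulOpposite.op (T.E b)) (fun b => -b)]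
  · rw [Finset.sum_eq_single (-a)]
    · rw [_root_.neg_neg, if_pos rfl]
    · intro b _ hb
      rw [if_neg]
      rintro rfl
      exact hb (by simp)
    · simp
  · have := map_sum (MulOpposite.opAddEquiv : A ≃+ Aᵐᵒᵖ) T.E Finset.univ
    rw [sum_E] at this
    exact this.symm
  · intro b
    rw [← MulOpposite.op_mul, mul_neg, E_mul_h, map_neg, neg_smul, MulOpposite.op_neg,
      MulOpposite.op_smul]

end TwistDatum

/-! ### Hopf axioms, antipode formula and noncocommutativity. -/

namespace TwistDatum

variable {R A : Type*} [CommRing R] [Ring A] [Algebra R A] {p : ℕ} [Fact p.Prime] [CharP R p]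
  (T : TwistDatum R A p) {G : Set A} (D : PrimitiveData R A G)

theorem conj_P {c : ZMod p} (a : ZMod p) : T.P a * T.P c * T.P (-a) = T.P c := by
  rw [P_mul_P, P_mul_P]; congr 1; ring

theorem coassoc (he : T.e ∈ G) (hh : T.h ∈ G) (hw : ∀ x ∈ G, ∃ c, T.IsWeight c x) :
    (Algebra.TensorProduct.assoc R R R A A A).toAlgHom.comp
      ((Algebra.TensorProduct.map (T.comul D) (.id R A)).comp (T.comul D)) =
    (Algebra.TensorProduct.map (.id R A) (T.comul D)).comp (T.comul D) := by
  refine AlgHom.ext_of_adjoin_eq_top D.adjoin_eq_top fun x hx => ?_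
  obtain ⟨c, hc⟩ := hw x hx
  have hl : ((Algebra.TensorProduct.assoc R R R A A A).toAlgHom.comp
      ((Algebra.TensorProduct.map (T.comul D) (.id R A)).comp (T.comul D))) x =
      x ⊗ₜ (T.P c ⊗ₜ T.P c) + ∑ a, T.E a ⊗ₜ[R] ((T.P a * x * T.P (-a)) ⊗ₜ[R] T.P c) +
      ∑ s, ∑ a, T.E a ⊗ₜ[R] ((T.P a * T.E (s - a) * T.P (-a)) ⊗ₜ[R] (T.P s * x * T.P (-s))) := by
    simp only [AlgHom.comp_apply, hc.comul_eq D hx, map_add, map_sum,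
      Algebra.TensorProduct.map_tmul, AlgHom.id_apply, T.comul_E D hh, TensorProduct.add_tmul,
      TensorProduct.sum_tmul, AlgEquiv.toAlgHom_apply, Algebra.TensorProduct.assoc_tmul]
  have hr : ((Algebra.TensorProduct.map (.id R A) (T.comul D)).comp (T.comul D)) x =
      x ⊗ₜ (T.P c ⊗ₜ T.P c) + (∑ a, T.E a ⊗ₜ[R] ((T.P a * x * T.P (-a)) ⊗ₜ[R] T.P c) +
      ∑ a, ∑ b, T.E a ⊗ₜ[R] ((T.P a * T.E b * T.P (-a)) ⊗ₜ[R]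
        (T.P (a + b) * x * T.P (-(a + b))))) := by
    rw [AlgHom.comp_apply, hc.comul_eq D hx, ← Finset.sum_add_distrib]
    simp only [map_add, map_sum, Algebra.TensorProduct.map_tmul, AlgHom.id_apply,
      T.comul_P D he, map_mul, hc.comul_eq D hx]
    congr 1
    refine Finset.sum_congr rfl fun a _ => ?_
    rw [mul_add, add_mul, TensorProduct.tmul_add, Algebra.TensorProduct.tmul_mul_tmul,
      Algebra.TensorProduct.tmul_mul_tmul, conj_P, Finset.mul_sum, Finset.sum_mul,
      TensorProduct.tmul_sum]
    congr 1
    refine Finset.sum_congr rfl fun b _ => ?_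
    rw [Algebra.TensorProduct.tmul_mul_tmul, Algebra.TensorProduct.tmul_mul_tmul, P_add, neg_add_rev,
      P_add]
    simp only [mul_assoc]
  -- The double sums agree after the substitution s = a + b.
  rw [hl, hr, add_assoc, Finset.sum_comm]
  congr 2
  refine Finset.sum_congr rfl fun a _ => Fintype.sum_equiv (Equiv.subRight a) _ _ fun s => ?_
  rw [Equiv.subRight_apply, add_sub_cancel]

theorem counit_left (hh : T.h ∈ G) (hw : ∀ x ∈ G, ∃ c, T.IsWeight c x) :
    (Algebra.TensorProduct.map D.counit (.id R A)).comp (T.comul D) =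
    (Algebra.TensorProduct.lid R A).symm := by
  refine AlgHom.ext_of_adjoin_eq_top D.adjoin_eq_top fun x hx => ?_
  obtain ⟨c, hc⟩ := hw x hx
  rw [AlgHom.comp_apply, hc.comul_eq D hx, map_add, map_sum]
  simp only [Algebra.TensorProduct.map_tmul, D.counit_gen x hx, T.counit_E D hh, AlgHom.id_apply,
    TensorProduct.zero_tmul, zero_add]
  rw [Finset.sum_eq_single 0]
  · simp [P_zero]
  · intro b _ hb
    rw [if_neg hb, TensorProduct.zero_tmul]
  · simp

theorem counit_right (he : T.e ∈ G) (hw : ∀ x ∈ G, ∃ c, T.IsWeight c x) :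
    (Algebra.TensorProduct.map (.id R A) D.counit).comp (T.comul D) =
    (Algebra.TensorProduct.rid R R A).symm := by
  refine AlgHom.ext_of_adjoin_eq_top D.adjoin_eq_top fun x hx => ?_
  obtain ⟨c, hc⟩ := hw x hx
  rw [AlgHom.comp_apply, hc.comul_eq D hx, map_add, map_sum]
  simp [D.counit_gen x hx, T.counit_P D he]

/-- The twisted antipode, as an anti-homomorphism. -/
def antipodeHom : A →ₐ[R] Aᵐᵒᵖ :=
  (conjAlgHom (Units.opEquiv.symm (MulOpposite.op T.VUnit))).comp D.antipode

/-- Conjugation by V in the opposite algebra is conjugation by V⁻¹ in A, and V⁻¹ is the same sum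
with parameter -t. -/
theorem antipode_apply (x : A) :
    antiLinear (T.antipodeHom D) x = T.neg.V * (D.antipode x).unop * T.V := by
  rw [antiLinear_apply, antipodeHom, AlgHom.comp_apply, conjAlgHom_apply, MulOpposite.unop_mul,
    MulOpposite.unop_mul, ← mul_assoc]
  rfl

theorem antipode_gen {x : A} (hx : x ∈ G) :
    antiLinear (T.antipodeHom D) x = -(T.neg.V * x * T.V) := by
  rw [antipode_apply, D.antipode_gen x hx, MulOpposite.unop_op, mul_neg, neg_mul]

theorem antipode_E_mul_P (hh : T.h ∈ G) (a : ZMod p) :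
    antiLinear (T.antipodeHom D) (T.E a) * T.P a = T.neg.V * T.E (-a) := by
  rw [antipode_apply, T.antipode_E D hh, MulOpposite.unop_op, mul_assoc T.neg.V, E_mul_V,
    mul_assoc, mul_assoc, P_neg_mul, mul_one]

/-- The untwisted antipode replaces 1 - et by 1 + et; conjugation by V turns powers of the latter
into inverse powers of 1 - et. -/
theorem antipode_P (he : T.e ∈ G) (a : ZMod p) :
    antiLinear (T.antipodeHom D) (T.P a) = T.P (-a) := by
  have h1 : D.antipode (T.P a) = MulOpposite.op (T.neg.P a) := by
    rw [P_eq_pow, P_eq_pow, map_pow, MulOpposite.op_pow, map_sub, map_smul, D.antipode_gen _ he]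
    simp [neg]
  rw [antipode_apply, h1, MulOpposite.unop_op, mul_assoc, neg_P_mul_V, ← mul_assoc, neg_V_mul_V,
    one_mul]

theorem antipode_left (hh : T.h ∈ G) (hw : ∀ x ∈ G, ∃ c, T.IsWeight c x) :
    LinearMap.mul' R A ∘ₗ (antiLinear (T.antipodeHom D)).rTensor A ∘ₗ (T.comul D).toLinearMap =
      Algebra.linearMap R A ∘ₗ D.counit.toLinearMap := by
  refine antipode_left_of_generators _ _ _ D.adjoin_eq_top fun x hx => ?_
  obtain ⟨c, hc⟩ := hw x hx
  rw [hc.comul_eq D hx, D.counit_gen x hx, map_zero, map_add, map_add, map_sum, map_sum]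
  simp only [LinearMap.rTensor_tmul, LinearMap.mul'_apply, ← mul_assoc, T.antipode_E_mul_P D hh]
  have h1 : ∑ a, T.neg.V * T.E (-a) * x * T.P (-a) = T.neg.V * x * T.V * T.P c := by
    rw [show T.V = ∑ a, T.E a * T.P a from rfl, Finset.mul_sum, Finset.sum_mul]
    refine Fintype.sum_equiv ((Equiv.neg _).trans (Equiv.subRight c)) _ _ fun a => ?_
    change _ = T.neg.V * x * (T.E (-a - c) * T.P (-a - c)) * T.P c
    rw [mul_assoc T.neg.V, hc.E_mul]
    simp only [mul_assoc, P_mul_P, sub_add_cancel]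
  rw [h1, T.antipode_gen D hx, neg_mul, neg_add_cancel]

theorem antipode_right (he : T.e ∈ G) (hw : ∀ x ∈ G, ∃ c, T.IsWeight c x) :
    LinearMap.mul' R A ∘ₗ (antiLinear (T.antipodeHom D)).lTensor A ∘ₗ (T.comul D).toLinearMap =
      Algebra.linearMap R A ∘ₗ D.counit.toLinearMap := by
  refine antipode_right_of_generators _ _ _ D.adjoin_eq_top fun x hx => ?_
  obtain ⟨c, hc⟩ := hw x hx
  rw [hc.comul_eq D hx, D.counit_gen x hx, map_zero, map_add, map_add, map_sum, map_sum]
  simp only [LinearMap.lTensor_tmul, LinearMap.mul'_apply, antiLinear_mul, T.antipode_P D he,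
    T.antipode_gen D hx, _root_.neg_neg]
  have h1 : ∀ a, T.E a * (T.P a * (-(T.neg.V * x * T.V) * T.P (-a))) =
      -(T.E a * x * T.P (-c)) := by
    intro a
    have : T.E a * T.P a * T.neg.V = T.E a := by
      rw [← E_mul_V, mul_assoc, V_mul_neg_V, mul_one]
    rw [neg_mul, mul_neg, mul_neg, ← mul_assoc, ← mul_assoc, ← mul_assoc, ← mul_assoc, this,
      hc.E_mul, mul_assoc x, E_mul_V, mul_assoc, mul_assoc, P_mul_P, mul_assoc]
    congr 5
    ring
  simp only [h1]
  rw [Finset.sum_neg_distrib, ← Finset.sum_mul, ← Finset.sum_mul, sum_E, one_mul, add_neg_cancel]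

/-- The Hopf algebra obtained by twisting. -/
def hopfStructure (he : T.e ∈ G) (hh : T.h ∈ G) (hw : ∀ x ∈ G, ∃ c, T.IsWeight c x) :
    HopfStructure R A where
  comul := T.comul D
  counit := D.counit
  antipode := antiLinear (T.antipodeHom D)
  coassoc := T.coassoc D he hh hw
  counit_left := T.counit_left D hh hw
  counit_right := T.counit_right D he hw
  antipode_left := T.antipode_left D hh hw
  antipode_right := T.antipode_right D he hw

variable {T} in
theorem IsWeight.antipode_formula {c : ZMod p} {x : A} (hc : T.IsWeight c x) (hx : x ∈ G)
    (r : ℕ → R) (hr : ∀ l < p, r l * (l ! : R) = 1) :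
    antiLinear (T.antipodeHom D) x = -(T.P (-c) * ∑ l ∈ Finset.range p,
      T.t ^ l • ((r l • (T.adE ^ l) x) * rising T.h 1 l)) := by
  rw [T.antipode_gen D hx, mul_assoc, hc.mul_V r hr, ← mul_assoc, neg_V_mul_V, one_mul]

/-- The twisted comultiplication of `h`. -/
theorem comul_h (hh : T.h ∈ G) : T.comul D T.h = 1 ⊗ₜ T.h + T.h ⊗ₜ T.P (-1) := by
  rw [T.isWeight_h.comul_eq D hh, P_zero]
  have h1 : ∀ a, T.P a * T.h * T.P (-a) =
      T.h - primeCast R a • (1 : A) + primeCast R a • T.P (-1) := by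
    intro a
    rw [P_mul_h, add_mul, sub_mul, smul_mul_assoc, smul_mul_assoc, mul_assoc, P_mul_neg, P_mul_P,
      mul_one]
    congr 3
    ring
  have h2 : ∀ y : A, ∑ a, T.E a ⊗ₜ[R] (primeCast R a • y) = T.h ⊗ₜ y := by
    intro y
    simp only [TensorProduct.tmul_smul, TensorProduct.smul_tmul', ← h_mul_E]
    rw [← TensorProduct.sum_tmul, ← Finset.mul_sum, sum_E, mul_one]
  simp only [h1, TensorProduct.tmul_add, TensorProduct.tmul_sub, Finset.sum_add_distrib,
    Finset.sum_sub_distrib, h2]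
  rw [← TensorProduct.sum_tmul, sum_E]
  abel

/-- The twist is not cocommutative as soon as a functional separates `h` from `e A`. -/
theorem not_cocommutative (he : T.e ∈ G) (hh : T.h ∈ G) (hw : ∀ x ∈ G, ∃ c, T.IsWeight c x)
    (f : A →ₗ[R] R) (hfh : f T.h = 1) (hfe : ∀ y, f (T.e * y) = 0) (hte : T.t • T.e ≠ 0) :
    ¬ (T.hopfStructure D he hh hw).Cocommutative := by
  intro hcc
  have h1 := hcc T.h
  change TensorProduct.comm R A A (T.comul D T.h) = T.comul D T.h at h1
  rw [comul_h T D hh, map_add, TensorProduct.comm_tmul, TensorProduct.comm_tmul] at h1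
  -- Contracting the first leg with f gives 1 + f((1-et)⁻¹) h = f(1) h + (1-et)⁻¹. Since (1-et)⁻¹
  -- lies in 1 + eA, the h-terms cancel and 1 - et = 1.
  have h2 := congrArg (fun z => TensorProduct.lid R A (f.rTensor A z)) h1
  simp only [map_add, LinearMap.rTensor_tmul, TensorProduct.lid_tmul, hfh, one_smul] at h2
  have h3 : f (T.P (-1)) = f 1 := by
    have h4 : T.P (-1) = 1 + T.t • (T.e * T.P (-1)) := by
      have := T.P_mul_neg 1
      rw [P_one, sub_mul, one_mul, smul_mul_assoc, sub_eq_iff_eq_add] at this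
      exact this
    rw [h4, map_add, map_smul, hfe, smul_zero, add_zero]
  rw [h3, add_comm] at h2
  have h4 := add_left_cancel h2
  have h5 := T.P_mul_neg 1
  rw [← h4, mul_one, P_one, sub_eq_self] at h5
  exact hte h5

end TwistDatum

/-! ### Weights of the basis under ad h, and the natural representation. -/

section BracketFormulas

variable (K : Type*) [Field K] (p : ℕ) {n : ℕ} [CharP K p]

theorem hW_dpow (k : Fin n) (α : Fin n → ℕ) :
    hW K p k (dpow K p α) = (α k : K) • dpow K p α := by
  have e : (∏ j, MvPolynomial.X j ^ α j : MvPolynomial (Fin n) K) =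
      MvPolynomial.monomial (Finsupp.equivFunOnFinite.symm α) 1 := by
    rw [MvPolynomial.monomial_eq, Finsupp.prod_fintype _ _ (by simp)]
    simp
  rw [dpow, Derivation.map_smul, smul_comm, hW, xD, Derivation.smul_apply, D_mk, dpow_single_one,
    oX, smul_eq_mul, ← map_mul, e, MvPolynomial.X_mul_pderiv_monomial]
  rw [map_nsmul, ← Nat.cast_smul_eq_nsmul K]
  rfl

variable [Fact p.Prime]

/-- Comparison on the variables: h acts on x^(α) by α_k and on x_i by δ_ik. This weight becomes the
exponent of 1 - et in the coproduct. -/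
theorem hW_lie_xD (k : Fin n) (α : Fin n → ℕ) (i : Fin n) :
    ⁅hW K p k, xD K p α i⁆ = ((α k : K) - if i = k then 1 else 0) • xD K p α i := by
  refine W_ext K p fun j => ?_
  have h1 : hW K p k (oX K p j) = if k = j then oX K p j else 0 := by
    rw [hW, xD_oX, dpow_single_one]
    split_ifs with h <;> simp [h]
  rw [Derivation.commutator_apply, h1, Derivation.smul_apply, xD_oX]
  by_cases hij : i = j
  · subst hij
    rw [if_pos rfl, hW_dpow, sub_smul]
    congr 1
    by_cases hk : i = k
    · subst hk; simp [xD_oX]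
    · simp [hk, Ne.symm hk]
  · rw [if_neg hij, map_zero, smul_zero, zero_sub, neg_eq_zero]
    split_ifs with h
    · rw [xD_oX, if_neg hij]
    · rw [map_zero]

theorem two_ne_zero_of_char (hp : p ≠ 2) : (2 : K) ≠ 0 := fun h => hp <|
  (Nat.prime_dvd_prime_iff_eq Fact.out Nat.prime_two).1 ((CharP.cast_eq_zero_iff K p 2).1 (by
    exact_mod_cast h))

theorem hW_lie_eW (k : Fin n) : ⁅hW K p k, eW K p k⁆ = eW K p k := by
  rw [eW]
  refine ((LieAlgebra.ad K (W K p n) (hW K p k)).map_smul (2 : K) (xD K p (Pi.single k 2) k)).trans ?_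
  rw [LieAlgebra.ad_apply, hW_lie_xD, Pi.single_eq_same, if_pos rfl]
  norm_num

theorem eW_apply (hp : p ≠ 2) (k : Fin n) (f : O K p n) :
    eW K p k f = oX K p k ^ 2 * D K p k f := by
  rw [eW, Derivation.smul_apply, xD, Derivation.smul_apply, dpow_single_two, smul_assoc, smul_smul,
    mul_inv_cancel₀ (two_ne_zero_of_char K p hp), one_smul, smul_eq_mul]

/-- The natural representation on `O(n; 1)`. -/
theorem exists_naturalRep : ∃ ρ : RestrictedU K p n →ₐ[K] Module.End K (O K p n),
    ∀ w, ρ (toU K p w) = (w : O K p n →ₗ[K] O K p n) :=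
  exists_lift_restrictedU K p (n := n)
    { toFun := fun w => (w : O K p n →ₗ[K] O K p n)
      map_add' := fun _ _ => rfl
      map_smul' := fun _ _ => rfl } (fun _ _ => Derivation.commutator_coe_linear_map)
    (fun i => xD_toral_pow K p i) (fun α i _ hne => xD_nil_pow K p α i hne)

end BracketFormulas

/-! ### Universal property and generators over K[t]/(t^p - qt). -/

section BaseChange

variable (K : Type*) [Field K] (p : ℕ) {n : ℕ} [CharP K p] (q : K)

theorem toUtq_eq (w : W K p n) : toUtq K p q w = 1 ⊗ₜ[K] toU K p w := rfl

theorem toUtq_add (v w : W K p n) : toUtq K p q (v + w) = toUtq K p q v + toUtq K p q w := by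
  simp only [toUtq_eq, map_add, TensorProduct.tmul_add]

theorem toUtq_smul (c : K) (w : W K p n) :
    toUtq K p q (c • w) = algebraMap K (BaseRing K p q) c • toUtq K p q w := by
  rw [toUtq_eq, toUtq_eq, map_smul, TensorProduct.tmul_smul, algebraMap_smul]

theorem toUtq_lie (v w : W K p n) : toUtq K p q ⁅v, w⁆ =
    toUtq K p q v * toUtq K p q w - toUtq K p q w * toUtq K p q v := by
  simp only [toUtq_eq, toU_lie, TensorProduct.tmul_sub, Algebra.TensorProduct.tmul_mul_tmul, mul_one]

theorem toUtq_toral (i : Fin n) : toUtq K p q (xD K p (Pi.single i 1) i) ^ p =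
    toUtq K p q (xD K p (Pi.single i 1) i) := by
  rw [toUtq_eq, Algebra.TensorProduct.tmul_pow, toU_toral, one_pow]

theorem toUtq_nil (α : Fin n → ℕ) (i : Fin n) (hα : ∀ j, α j < p) (hne : α ≠ Pi.single i 1) :
    toUtq K p q (xD K p α i) ^ p = 0 := by
  rw [toUtq_eq, Algebra.TensorProduct.tmul_pow, toU_nil K p α i hα hne, TensorProduct.tmul_zero]

variable {K p} in
/-- Maps from `W(n; 1)` to an algebra over a `K`-algebra `R` that satisfy the defining relations of
the restricted enveloping algebra. -/
structure RestrictedMap (R : Type*) {B : Type*} [CommRing R] [Algebra K R] [Ring B] [Algebra R B]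
    (f : W K p n → B) : Prop where
  map_add : ∀ v w, f (v + w) = f v + f w
  map_smul : ∀ (c : K) w, f (c • w) = algebraMap K R c • f w
  map_lie : ∀ v w, f ⁅v, w⁆ = f v * f w - f w * f v
  toral : ∀ i, f (xD K p (Pi.single i 1) i) ^ p = f (xD K p (Pi.single i 1) i)
  nil : ∀ (α : Fin n → ℕ) (i : Fin n), (∀ j, α j < p) → α ≠ Pi.single i 1 → f (xD K p α i) ^ p = 0

theorem restrictedMap_toUtq : RestrictedMap (BaseRing K p q) (toUtq K p q (n := n)) where
  map_add := toUtq_add K p q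
  map_smul := toUtq_smul K p q
  map_lie := toUtq_lie K p q
  toral := toUtq_toral K p q
  nil := toUtq_nil K p q

namespace RestrictedMap

variable {K p} {R B : Type*} [CommRing R] [Algebra K R] [Ring B] [Algebra R B] {f : W K p n → B}

theorem zero [Fact p.Prime] : RestrictedMap R (fun _ : W K p n => (0 : B)) := by
  have hp : p ≠ 0 := (Fact.out : p.Prime).ne_zero
  constructor <;> simp [hp]

theorem add_pow_char_of_commute [Fact p.Prime] [CharP R p] {x y : B} (h : Commute x y) :
    (x + y) ^ p = x ^ p + y ^ p := by
  have h0 : (p : B) = 0 := by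
    rw [← map_natCast (algebraMap R B), CharP.cast_eq_zero, _root_.map_zero]
  rw [h.add_pow_prime_eq Fact.out, h0]
  simp

/-- The two tensor legs commute, so the p-th power is additive on them and the restricted relations
persist. -/
theorem primitive (hf : RestrictedMap R f) [Fact p.Prime] [CharP R p] :
    RestrictedMap R fun w => f w ⊗ₜ[R] (1 : B) + (1 : B) ⊗ₜ[R] f w := by
  have hpow : ∀ x : B, (x ⊗ₜ[R] (1 : B) + (1 : B) ⊗ₜ[R] x) ^ p =
      (x ^ p) ⊗ₜ 1 + 1 ⊗ₜ (x ^ p) := by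
    intro x
    have hc : Commute (x ⊗ₜ[R] (1 : B)) ((1 : B) ⊗ₜ[R] x) := by
      rw [Commute, SemiconjBy, Algebra.TensorProduct.tmul_mul_tmul,
        Algebra.TensorProduct.tmul_mul_tmul, one_mul, mul_one]
    rw [add_pow_char_of_commute (R := R) hc, Algebra.TensorProduct.tmul_pow,
      Algebra.TensorProduct.tmul_pow, one_pow]
  refine ⟨fun v w => ?_, fun c w => ?_, fun v w => ?_, fun i => ?_, fun α i hα hne => ?_⟩
  · rw [hf.map_add, TensorProduct.add_tmul, TensorProduct.tmul_add]
    abel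
  · rw [hf.map_smul, ← TensorProduct.smul_tmul', TensorProduct.tmul_smul, smul_add]
  · simp only [hf.map_lie, TensorProduct.sub_tmul, TensorProduct.tmul_sub, add_mul, mul_add,
      Algebra.TensorProduct.tmul_mul_tmul, one_mul, mul_one]
    abel
  · rw [hpow, hf.toral]
  · rw [hpow, hf.nil α i hα hne, TensorProduct.zero_tmul, TensorProduct.tmul_zero, add_zero]

theorem op_neg (hf : RestrictedMap R f) (hp : Odd p) :
    RestrictedMap R fun w => MulOpposite.op (-f w) := by
  refine ⟨fun v w => ?_, fun c w => ?_, fun v w => ?_, fun i => ?_, fun α i hα hne => ?_⟩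
  · rw [hf.map_add, neg_add, MulOpposite.op_add]
  · rw [hf.map_smul, ← smul_neg, MulOpposite.op_smul]
  · rw [hf.map_lie, ← MulOpposite.op_mul, ← MulOpposite.op_mul, ← MulOpposite.op_sub, neg_mul_neg,
      neg_mul_neg, neg_sub]
  · rw [← MulOpposite.op_pow, hp.neg_pow, hf.toral]
  · rw [← MulOpposite.op_pow, hp.neg_pow, hf.nil α i hα hne, neg_zero, MulOpposite.op_zero]

end RestrictedMap

/-- The universal property of `u_{t,q}(W(n; 1))`. -/
theorem RestrictedMap.exists_lift {B : Type*} [Ring B] [Algebra (BaseRing K p q) B]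
    {f : W K p n → B} (hf : RestrictedMap (BaseRing K p q) f) :
    ∃ F : Utq K p n q →ₐ[BaseRing K p q] B, ∀ w, F (toUtq K p q w) = f w := by
  let _ : Algebra K B := Algebra.compHom B (algebraMap K (BaseRing K p q))
  have : IsScalarTower K (BaseRing K p q) B := IsScalarTower.of_algebraMap_eq fun _ => rfl
  obtain ⟨F, hF⟩ := exists_lift_restrictedU K p (B := B)
    { toFun := f
      map_add' := hf.map_add
      map_smul' := fun c w => by rw [hf.map_smul, algebraMap_smul]; rfl } hf.map_lie hf.toral hf.nil
  have hc : ∀ x y, Commute (Algebra.ofId (BaseRing K p q) B x) (F y) :=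
    fun x y => Algebra.commutes x (F y)
  refine ⟨Algebra.TensorProduct.lift (Algebra.ofId _ B) F hc, fun w => ?_⟩
  refine (Algebra.TensorProduct.lift_tmul _ _ hc 1 (toU K p w)).trans ?_
  rw [_root_.map_one, one_mul, hF]
  rfl

variable [Fact p.Prime]

/-- The images of the scalar multiples of the basis elements `x^(α) D_i`. -/
def basisImage (n : ℕ) : Set (Utq K p n q) :=
  Set.range fun a : K × ((Fin n → Fin p) × Fin n) => toUtq K p q (a.1 • xDBasis K p a.2)

theorem toUtq_mem_span (w : W K p n) :
    toUtq K p q w ∈ Submodule.span (BaseRing K p q) (basisImage K p q n) := by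
  have hw : w ∈ Submodule.span K (Set.range (xDBasis K p (n := n))) := by
    rw [span_xDBasis]; trivial
  induction hw using Submodule.span_induction with
  | mem w hw => obtain ⟨a, rfl⟩ := hw; exact Submodule.subset_span ⟨(1, a), by simp only [one_smul]⟩
  | zero => rw [toUtq_eq, map_zero, TensorProduct.tmul_zero]; exact zero_mem _
  | add v w _ _ hv hw => rw [toUtq_add]; exact add_mem hv hw
  | smul c w _ hw => rw [toUtq_smul]; exact Submodule.smul_mem _ _ hw

theorem adjoin_basisImage : Algebra.adjoin (BaseRing K p q) (basisImage K p q n) = ⊤ := by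
  rw [eq_top_iff]
  intro z _
  set S := Algebra.adjoin (BaseRing K p q) (basisImage K p q n) with hS
  have h1 : ∀ y : RestrictedU K p n, (1 : BaseRing K p q) ⊗ₜ[K] y ∈ S := by
    intro y
    have hy : y ∈ Algebra.adjoin K (Set.range (toU K p (n := n))) := by rw [adjoin_toU]; trivial
    induction hy using Algebra.adjoin_induction with
    | mem y hy =>
      obtain ⟨w, rfl⟩ := hy
      exact Algebra.span_le_adjoin _ _ (toUtq_mem_span K p q w)
    | algebraMap c =>
      rw [Algebra.algebraMap_eq_smul_one, TensorProduct.tmul_smul, ← algebraMap_smul (BaseRing K p q)]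
      exact Subalgebra.smul_mem _ (one_mem S) _
    | add x y _ _ hx hy => rw [TensorProduct.tmul_add]; exact add_mem hx hy
    | mul x y _ _ hx hy =>
      have : (1 : BaseRing K p q) ⊗ₜ[K] (x * y) = (1 ⊗ₜ x) * (1 ⊗ₜ y) := by
        rw [Algebra.TensorProduct.tmul_mul_tmul, one_mul]
      rw [this]; exact mul_mem hx hy
  induction z using TensorProduct.induction_on with
  | zero => exact zero_mem S
  | add x y hx hy => exact add_mem (hx trivial) (hy trivial)
  | tmul r y =>
    have : r ⊗ₜ[K] y = r • ((1 : BaseRing K p q) ⊗ₜ[K] y) := by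
      rw [TensorProduct.smul_tmul', smul_eq_mul, mul_one]
    rw [this]
    exact Subalgebra.smul_mem _ (h1 y) r

end BaseChange

/-! ### Matrix coefficients separating h from eA. -/

section Functionals

variable (K : Type*) [Field K] (p : ℕ) {n : ℕ} [CharP K p] [Fact p.Prime] (q : K)

/-- The matrix coefficients of the natural representation at `x_k`, extended to
`u_{t,q}(W(n; 1))`. -/
theorem exists_functional (k : Fin n) (β : Fin n → Fin p) :
    ∃ f : Utq K p n q →ₗ[BaseRing K p q] BaseRing K p q,
      (∀ w, f (toUtq K p q w) = algebraMap K _ (ocoeff K p β (w (oX K p k)))) ∧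
      ∀ w, (∀ g, ocoeff K p β (w g) = 0) → ∀ y, f (toUtq K p q w * y) = 0 := by
  obtain ⟨ρ, hρ⟩ := exists_naturalRep K p (n := n)
  let f₀ : RestrictedU K p n →ₗ[K] BaseRing K p q :=
    Algebra.linearMap K _ ∘ₗ ocoeff K p β ∘ₗ LinearMap.applyₗ (oX K p k) ∘ₗ ρ.toLinearMap
  have hf₀ : ∀ y, f₀ y = algebraMap K _ (ocoeff K p β (ρ y (oX K p k))) := fun _ => rfl
  refine ⟨f₀.liftBaseChange _, fun w => ?_, fun w hw y => ?_⟩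
  · rw [toUtq_eq, LinearMap.liftBaseChange_tmul, one_smul, hf₀, hρ]
    rfl
  · induction y using TensorProduct.induction_on with
    | zero => rw [mul_zero, map_zero]
    | add x y hx hy => rw [mul_add, map_add, hx, hy, add_zero]
    | tmul r y =>
      rw [toUtq_eq, Algebra.TensorProduct.tmul_mul_tmul, LinearMap.liftBaseChange_tmul, hf₀,
        map_mul, Module.End.mul_apply, hρ]
      have := hw (ρ y (oX K p k))
      rw [← Derivation.coeFn_coe] at this
      rw [this, map_zero, smul_zero]

theorem ocoeff_eW (hp : p ≠ 2) (k : Fin n) (β : Fin n → Fin p) (hβ : (β k : ℕ) < 2) (g : O K p n) :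
    ocoeff K p β (eW K p k g) = 0 := by
  obtain ⟨g, rfl⟩ := Ideal.Quotient.mk_surjective g
  rw [eW_apply K p hp, D_mk, oX, ← map_pow, ← map_mul, ocoeff_mk, MvPolynomial.X_pow_eq_monomial,
    MvPolynomial.coeff_monomial_mul', if_neg]
  rw [Finsupp.single_le_iff]
  simpa [expFinsupp] using hβ

theorem exists_functional_separating (hp : p ≠ 2) (k : Fin n) :
    ∃ f : Utq K p n q →ₗ[BaseRing K p q] BaseRing K p q, f (toUtq K p q (hW K p k)) = 1 ∧
      ∀ y, f (toUtq K p q (eW K p k) * y) = 0 := by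
  have hp1 : 1 < p := (Fact.out : p.Prime).one_lt
  -- The coefficient of x_k: h fixes x_k, while everything in the image of e is divisible by x_k^2.
  set β : Fin n → Fin p := fun j => ⟨(Pi.single k 1 : Fin n → ℕ) j, by
    by_cases h : j = k
    · subst h; simpa using hp1
    · simpa [h] using hp1.pos⟩ with hβ
  obtain ⟨f, hf, hf'⟩ := exists_functional K p q k β
  refine ⟨f, ?_, hf' _ (ocoeff_eW K p hp k β (by simp [hβ]))⟩
  have : hW K p k (oX K p k) = omono K p β := by
    rw [hW, xD_oX, if_pos rfl, dpow_single_one, omono_eq_prod, Finset.prod_eq_single k]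
    · simp [hβ]
    · intro b _ hb; simp [hβ, hb]
    · simp
  rw [hf, this, ocoeff_omono, if_pos rfl, map_one]

theorem smul_toUtq_eW_ne_zero (hp : p ≠ 2) (k : Fin n) {r : BaseRing K p q} (hr : r ≠ 0) :
    r • toUtq K p q (eW K p k) ≠ 0 := by
  have hp2 : 2 < p := lt_of_le_of_ne (Fact.out : p.Prime).two_le (Ne.symm hp)
  -- The coefficient of x_k^2, because e sends x_k to x_k^2, which is nonzero as p > 2.
  set β : Fin n → Fin p := fun j => ⟨(Pi.single k 2 : Fin n → ℕ) j, by
    by_cases h : j = k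
    · subst h; simpa using hp2
    · simp only [Pi.single_apply, h, if_false]; omega⟩ with hβ
  obtain ⟨f, hf, -⟩ := exists_functional K p q k β
  have : eW K p k (oX K p k) = omono K p β := by
    rw [eW_apply K p hp, D_oX, if_pos rfl, mul_one, omono_eq_prod, Finset.prod_eq_single k]
    · simp [hβ]
    · intro b _ hb; simp [hβ, hb]
    · simp
  intro h
  have h2 := congrArg f h
  rw [map_smul, hf, this, ocoeff_omono, if_pos rfl, map_one, map_zero, smul_eq_mul, mul_one] at h2
  exact hr h2

end Functionals

/-! ### The untwisted Hopf data and the twisting datum. -/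

section PrimitiveStructure

variable (K : Type*) [Field K] (p : ℕ) {n : ℕ} [CharP K p] [Fact p.Prime] (q : K)

theorem exists_primitiveData (hp : p ≠ 2) :
    ∃ D : PrimitiveData (BaseRing K p q) (Utq K p n q) (basisImage K p q n),
      ∀ w, D.counit (toUtq K p q w) = 0 := by
  have hchar := charP_baseRing K p q
  have hU := restrictedMap_toUtq K p q (n := n)
  obtain ⟨Δ, hΔ⟩ := hU.primitive.exists_lift K p q
  obtain ⟨ε, hε⟩ := (RestrictedMap.zero (K := K) (p := p) (n := n) (R := BaseRing K p q)
    (B := BaseRing K p q)).exists_lift K p q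
  obtain ⟨S, hS⟩ := (hU.op_neg ((Fact.out : p.Prime).odd_of_ne_two hp)).exists_lift K p q
  refine ⟨⟨Δ, ε, S, adjoin_basisImage K p q, ?_, ?_, ?_⟩, hε⟩
  · rintro _ ⟨a, rfl⟩; exact hΔ _
  · rintro _ ⟨a, rfl⟩; exact hε _
  · rintro _ ⟨a, rfl⟩; exact hS _

/-- The twisting datum of `u_{t,q}(W(n; 1))`. -/
def twistDatum (hp : p ≠ 2) (k : Fin n) : TwistDatum (BaseRing K p q) (Utq K p n q) p where
  h := toUtq K p q (hW K p k)
  e := toUtq K p q (eW K p k)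
  t := t K p q
  h_pow := toUtq_toral K p q k
  e_pow := by
    have hp2 : 2 < p := lt_of_le_of_ne (Fact.out : p.Prime).two_le (Ne.symm hp)
    rw [eW, toUtq_smul, smul_pow, toUtq_nil, smul_zero]
    · intro j
      rw [Pi.single_apply]
      split_ifs
      · exact hp2
      · omega
    · intro h
      have := congrFun h k
      simp at this
  h_mul_e := by
    have := toUtq_lie K p q (hW K p k) (eW K p k)
    rw [hW_lie_eW] at this
    exact sub_eq_iff_eq_add'.1 this.symm

/-- The weight is written as the image of an integer so that residue powers of 1 - et become integer
powers of the unit. -/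
theorem isWeight_toUtq_xD (hp : p ≠ 2) (k : Fin n) [CharP (BaseRing K p q) p] (α : Fin n → ℕ)
    (i : Fin n) : (twistDatum K p q hp k).IsWeight
      ((((α k : ℤ) - if i = k then 1 else 0 : ℤ)) : ZMod p) (toUtq K p q (xD K p α i)) := by
  have h1 := toUtq_lie K p q (hW K p k) (xD K p α i)
  rw [hW_lie_xD, toUtq_smul, eq_sub_iff_add_eq, add_comm] at h1
  have h2 : primeCast (BaseRing K p q) ((((α k : ℤ) - if i = k then 1 else 0 : ℤ)) : ZMod p) =
      algebraMap K (BaseRing K p q) ((α k : K) - if i = k then 1 else 0) := by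
    split_ifs <;> simp
  rw [TwistDatum.IsWeight, h2]
  exact h1.symm

theorem toUtq_dOp (hp : p ≠ 2) (k : Fin n) (l : ℕ) (w : W K p n) : toUtq K p q (dOp K p k l w) =
    algebraMap K (BaseRing K p q) ((l ! : K))⁻¹ •
      ((twistDatum K p q hp k).adE ^ l) (toUtq K p q w) := by
  rw [dOp, toUtq_smul]
  congr 1
  induction l with
  | zero => rfl
  | succ l ih =>
    rw [pow_succ', pow_succ', Module.End.mul_apply, Module.End.mul_apply, ← ih, LieAlgebra.ad_apply,
      toUtq_lie]
    rfl

end PrimitiveStructure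

end JacobsonWitt

end

/-! ### Assembly of the theorem. -/

open JacobsonWitt in
theorem theorem3p5 (K : Type*) [Field K] (p : ℕ) [Fact p.Prime] [CharP K p] (hp : p ≠ 2)
    (n : ℕ) (k : Fin n) (q : K) :
    ⁅hW K p k, eW K p k⁆ = eW K p k ∧
    (∃ a b : Utq K p n q, a * b ≠ b * a) ∧
    (∃ (U : (Utq K p n q)ˣ) (H : HopfStructure (BaseRing K p q) (Utq K p n q)),
      (U : Utq K p n q) = 1 - t K p q • toUtq K p q (eW K p k) ∧
      ¬ H.Cocommutative ∧
      ∀ (α : Fin n → ℕ) (i : Fin n), (∀ j, α j < p) →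
        H.comul (toUtq K p q (xD K p α i)) =
            toUtq K p q (xD K p α i) ⊗ₜ[BaseRing K p q]
              ((U ^ ((α k : ℤ) - if i = k then 1 else 0) : (Utq K p n q)ˣ) : Utq K p n q) +
            ∑ ℓ ∈ Finset.range p, (-1 : BaseRing K p q) ^ ℓ •
              (rising (toUtq K p q (hW K p k)) 0 ℓ ⊗ₜ[BaseRing K p q]
                (t K p q ^ ℓ • (((U ^ (-(ℓ : ℤ)) : (Utq K p n q)ˣ) : Utq K p n q) *
                  toUtq K p q (dOp K p k ℓ (xD K p α i))))) ∧
        H.antipode (toUtq K p q (xD K p α i)) =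
            -(((U ^ ((if i = k then 1 else 0) - (α k : ℤ)) : (Utq K p n q)ˣ) : Utq K p n q) *
              ∑ ℓ ∈ Finset.range p, t K p q ^ ℓ •
                (toUtq K p q (dOp K p k ℓ (xD K p α i)) *
                  rising (toUtq K p q (hW K p k)) 1 ℓ)) ∧
        H.counit (toUtq K p q (xD K p α i)) = 0) ∧
    Module.Finite K (Utq K p n q) ∧
    Module.finrank K (Utq K p n q) = p ^ (1 + n * p ^ n) := by
  have hprime : p.Prime := Fact.out
  have hp2 : 2 < p := lt_of_le_of_ne hprime.two_le (Ne.symm hp)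
  have hchar := charP_baseRing K p q
  obtain ⟨D, hε⟩ := exists_primitiveData K p q (n := n) hp
  set T := twistDatum K p q hp k
  have hmem : ∀ (α : Fin n → ℕ) i, (∀ j, α j < p) →
      toUtq K p q (xD K p α i) ∈ basisImage K p q n := fun α i hα =>
    ⟨(1, fun j => ⟨α j, hα j⟩, i), by simp only [one_smul]; rfl⟩
  have hw : ∀ x ∈ basisImage K p q n, ∃ c, T.IsWeight c x := by
    rintro _ ⟨a, rfl⟩
    simp only [toUtq_smul]
    exact ⟨_, (isWeight_toUtq_xD K p q hp k _ _).smul _⟩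
  have hh : T.h ∈ basisImage K p q n := hmem _ _ fun j => by
    rw [Pi.single_apply]; split_ifs <;> omega
  -- The generating set admits scalar multiples precisely because e is twice a basis element.
  have he : T.e ∈ basisImage K p q n :=
    ⟨(2, fun j => ⟨(Pi.single k 2 : Fin n → ℕ) j, by rw [Pi.single_apply]; split_ifs <;> omega⟩, k),
      rfl⟩
  -- Factorials below p are invertible, which supplies the coefficients 1/ℓ! of the divided powers
  -- of ad e.
  have hr : ∀ l < p, algebraMap K (BaseRing K p q) ((l ! : K))⁻¹ * (l ! : BaseRing K p q) = 1 := by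
    intro l hl
    rw [← map_natCast (algebraMap K (BaseRing K p q)) (l !), ← map_mul,
      inv_mul_cancel₀ (factorial_ne_zero K p hl), map_one]
  have hne : ∀ r : BaseRing K p q, r ≠ 0 → r • T.e ≠ 0 := fun r hr =>
    smul_toUtq_eW_ne_zero K p q hp k hr
  have hnontriv := nontrivial_baseRing K p q
  refine ⟨hW_lie_eW K p k, ⟨T.h, T.e, fun hcomm => ?_⟩,
    ⟨T.U, T.hopfStructure D he hh hw, rfl, ?_, fun α i hα => ⟨?_, ?_, hε _⟩⟩, finite_finrank_Utq K p q⟩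
  · rw [T.h_mul_e, add_eq_left] at hcomm
    exact hne 1 one_ne_zero (by rw [one_smul]; exact hcomm)
  · obtain ⟨f, hfh, hfe⟩ := exists_functional_separating K p q hp k
    exact T.not_cocommutative D he hh hw f hfh hfe (hne _ (t_ne_zero K p q))
  · have h1 := (isWeight_toUtq_xD K p q hp k α i).comul_formula D (hmem α i hα) _ hr
    rw [T.P_intCast] at h1
    refine h1.trans ?_
    congr 1
    refine Finset.sum_congr rfl fun l _ => ?_
    rw [toUtq_dOp K p q hp, ← T.P_intCast, Int.cast_neg, Int.cast_natCast]
    rfl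
  · have h1 := (isWeight_toUtq_xD K p q hp k α i).antipode_formula D (hmem α i hα) _ hr
    rw [← Int.cast_neg, T.P_intCast, neg_sub] at h1
    refine h1.trans ?_
    simp only [toUtq_dOp K p q hp]
    rfl
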